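/- Let $F(a,b)$ be the free group with basis $\{a,b\}$. A subgroup $M$ of a group $H$ is called \emph{malcharacteristic} in $H$ if every automorphism $\delta\in\operatorname{Aut}(H)$ with $\delta(M)\cap M\neq 1$ is of the form $x\mapsto h^{-1}xh$ for some $h\in M$. For every cardinal $n\le\aleph_0$ (that is, every finite $n$, and $n$ countably infinite) the free group $F(a,b)$ contains a malcharacteristic subgroup $L_n$ which is free of rank $n$. Moreover, such subgroups can be found inside an explicit one: for an integer $\rho\ge 1$ let $$\omega_x=a^3b^3a^3b^4\cdots a^3b^{\rho+2},\qquad \omega_y=a^3b^{\rho+3}a^3b^{\rho+4}\cdots a^3b^{2\rho+2},\qquad L^{(\rho)}=\langle\omega_x,\omega_y\rangle\le F(a,b).$$ There is an integer $\rho_0$ such that for every $\rho\ge\rho_0$ the subgroup $L^{(\rho)}$ is malcharacteristic in $F(a,b)$ and free of rank two, and for every cardinal $n\le\aleph_0$ there is a subgroup $L_n\le L^{(\rho)}$ which is malcharacteristic in $F(a,b)$ and free of rank $n$. -/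

import Mathlib

/-- A subgroup `M` of `H` is malcharacteristic in `H` if every automorphism `δ` of `H` with
`δ(M) ∩ M ≠ 1` is conjugation by an element of `M`. Here `MulAut.conj h` is `x ↦ h * x * h⁻¹`, so
`M.map MulAut.conj` is the group `Inn(M) = {γ_h : h ∈ M}` (with `γ_h x = h⁻¹ * x * h`, since `M` is
closed under inverses). -/
def Subgroup.IsMalcharacteristic {H : Type*} [Group H] (M : Subgroup H) : Prop :=
  ∀ δ : MulAut H, M.map δ.toMonoidHom ⊓ M ≠ ⊥ → δ ∈ M.map (MulAut.conj : H →* MulAut H)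

/-- The group `G` is free of rank `κ`: it has a free basis of cardinality `κ`. -/
def IsFreeOfRank (G : Type) [Group G] (κ : Cardinal.{0}) : Prop :=
  ∃ ι : Type, Cardinal.mk ι = κ ∧ Nonempty (FreeGroupBasis ι G)

namespace SeedSubgroup

/-- The first generator of the free group `F(a, b) = FreeGroup (Fin 2)`. -/
def a : FreeGroup (Fin 2) := FreeGroup.of 0

/-- The second generator of the free group `F(a, b) = FreeGroup (Fin 2)`. -/
def b : FreeGroup (Fin 2) := FreeGroup.of 1

/-- The word `a³ bˢ a³ bˢ⁺¹ ⋯ a³ bˢ⁺ᵏ⁻¹`, with `k` syllable pairs. -/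
def block (s k : ℕ) : FreeGroup (Fin 2) :=
  ((List.range k).map fun i => a ^ 3 * b ^ (s + i)).prod

/-- `ω_x = a³ b³ a³ b⁴ ⋯ a³ b^(ρ+2)`. -/
def omegaX (ρ : ℕ) : FreeGroup (Fin 2) := block 3 ρ

/-- `ω_y = a³ b^(ρ+3) a³ b^(ρ+4) ⋯ a³ b^(2ρ+2)`. -/
def omegaY (ρ : ℕ) : FreeGroup (Fin 2) := block (ρ + 3) ρ

/-- The subgroup `L = ⟨ω_x, ω_y⟩` of `F(a, b)`. -/
def L (ρ : ℕ) : Subgroup (FreeGroup (Fin 2)) := Subgroup.closure {omegaX ρ, omegaY ρ}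

end SeedSubgroup

/-! A word of `F(a, b)` is read as a list of pairs: the sign of an `a`-letter and the exponent of
`b` (the gap) before the next one. In a `SyncCode`, products of generators become, up to bounded
corrections, such lists without cancellation, and each factor opens with an entry that occurs
nowhere else. If `g` conjugates one element of the subgroup to another, the cyclic word of one runs
along a power of the other (`exists_prefix_wordPow`). Its opening entry can only lie at the start of
a factor, so `g` itself is spelled by generators. Hence the generators are free
(`SyncCode.lift_injective`) and the subgroup is malnormal (`SyncCode.malnormal`). Both `ω_x, ω_y`
(`seedCode`) and a suitable family of any countable rank (`oddCode`) are such codes.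

Let now `δ` be an automorphism that sends some `g ≠ 1` of `L` into `L`. Nielsen's method shows that
inner automorphisms, signed permutations of the basis and one transvection generate the automorphism
group (`mem_elementaryGroup`). Rewriting turns `δ`, up to inner automorphisms and signed
permutations on both sides, into a product `M` of the positive transvections `a ↦ ab` and `b ↦ ba`
(`isPositivelyDecomposed`). A positive transvection lengthens every cyclic word in which adjacent
letters of different type and opposite sign are rare, and keeps them rare
(`HasProfile.transvection_apply`). In cyclic words from `L` two gaps out of three vanish, so changes
of letter type are rare altogether (`hasProfile_code`). Thus `M ≠ 1` forces `δ g` to be longer than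
`g`. As the same applies to `δ⁻¹`, `δ` is a signed permutation up to conjugation
(`HasProfile.exists_eq_conj_mul`).

That permutation is trivial: elements of `L` have more `b`'s than `a`'s, which forbids the exchange,
and their gaps climb by steps of one, which forbids sign changes (`eq_true_of_infix`). So `δ` is
inner, and malnormality puts the conjugator in `L`. For other ranks, transport the malnormal
`oddCode` subgroup into `L ≅ F₂` (`isMalcharacteristic_range_comp`). -/

/-! ### Cancellation and conjugacy of cyclically reduced words. -/

namespace FreeGroup

open List

variable {α : Type*}

theorem IsReduced.exists_cancellation {u v : List (α × Bool)} (hu : IsReduced u)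
    (hv : IsReduced v) : ∃ p q r, u = p ++ q ∧ v = invRev q ++ r ∧ IsReduced (p ++ r) := by
  induction u using List.reverseRecOn generalizing v with
  | nil => exact ⟨[], [], v, by simp, by simp, by simpa using hv⟩
  | append_singleton u x ih =>
    rcases v with _ | ⟨y, v⟩
    · exact ⟨u ++ [x], [], [], by simp, by simp, by simpa using hu⟩
    · by_cases hxy : x.1 = y.1 → x.2 = y.2
      · refine ⟨u ++ [x], [], y :: v, by simp, by simp, ?_⟩
        unfold IsReduced at *
        rw [List.isChain_append] at hu ⊢
        · refine ⟨List.isChain_append.2 hu, hv, ?_⟩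
          intro z hz w hw
          simp only [getLast?_append, getLast?_singleton, Option.some_or, Option.mem_def,
            Option.some.injEq, head?_cons] at hz hw
          subst hz hw
          exact hxy
      · obtain ⟨p, q, r, h1, h2, h3⟩ := ih (v := v) (hu.infix ⟨[], [x], by simp⟩)
          (hv.infix ⟨[y], [], by simp⟩)
        refine ⟨p, q ++ [x], r, by simp [h1], ?_, h3⟩
        obtain ⟨x1, x2⟩ := x
        obtain ⟨y1, y2⟩ := y
        simp only [Classical.not_imp] at hxy
        obtain ⟨rfl, hne⟩ := hxy
        have : y2 = !x2 := by cases x2 <;> cases y2 <;> simp_all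
        subst this
        simp [h2, invRev]

theorem toWord_mk_of_isReduced [DecidableEq α] {u : List (α × Bool)} (hu : IsReduced u) :
    (mk u).toWord = u := by
  rw [toWord_mk, hu.reduce_eq]

theorem exists_toWord_mul [DecidableEq α] (x y : FreeGroup α) :
    ∃ p q r, x.toWord = p ++ q ∧ y.toWord = invRev q ++ r ∧ (x * y).toWord = p ++ r := by
  obtain ⟨p, q, r, h1, h2, h3⟩ := (isReduced_toWord (x := x)).exists_cancellation
    (isReduced_toWord (x := y))
  refine ⟨p, q, r, h1, h2, ?_⟩
  have : x * y = mk (p ++ r) := by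
    conv_lhs => rw [← mk_toWord (x := x), ← mk_toWord (x := y), h1, h2]
    rw [← mul_mk, ← mul_mk, ← mul_mk, ← inv_mk]
    group
  rw [this, toWord_mk_of_isReduced h3]

/-- The word `u` repeated `n` times. -/
def wordPow (u : List (α × Bool)) (n : ℕ) : List (α × Bool) := (List.replicate n u).flatten

theorem mk_wordPow (u : List (α × Bool)) (n : ℕ) : mk (wordPow u n) = mk u ^ n :=
  (pow_mk n).symm

theorem length_wordPow (u : List (α × Bool)) (n : ℕ) : (wordPow u n).length = n * u.length := by
  simp [wordPow]

theorem countP_wordPow (p : α × Bool → Bool) (u : List (α × Bool)) (n : ℕ) :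
    (wordPow u n).countP p = n * u.countP p := by
  simp [wordPow, countP_flatten]

theorem IsCyclicallyReduced.toWord_pow [DecidableEq α] {u : List (α × Bool)}
    (hu : IsCyclicallyReduced u) (n : ℕ) : (mk u ^ n).toWord = wordPow u n := by
  rw [← mk_wordPow]
  exact toWord_mk_of_isReduced (hu.flatten_replicate n).isReduced

/-- Passing to `n`-th powers multiplies both counts by `n`, whereas the conjugator contributes a
bounded error; large `n` decides. -/
theorem countP_le_of_conj [DecidableEq α] {u v : List (α × Bool)} (hu : IsCyclicallyReduced u)
    {g : FreeGroup α} (h : mk u = g * mk v * g⁻¹) (p : α × Bool → Bool)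
    (hv : IsCyclicallyReduced v) : u.countP p ≤ v.countP p := by
  have key : ∀ n : ℕ, n * u.countP p ≤ n * v.countP p + g.toWord.countP p
      + g⁻¹.toWord.countP p := by
    intro n
    have h1 : mk u ^ n = g * (mk v ^ n) * g⁻¹ := by rw [h, conj_pow]
    have h2 := (toWord_mul_sublist (g * mk v ^ n) g⁻¹).countP_le (p := p)
    have h3 := (toWord_mul_sublist g (mk v ^ n)).countP_le (p := p)
    rw [← h1, hu.toWord_pow, countP_wordPow, countP_append] at h2
    rw [countP_append, hv.toWord_pow, countP_wordPow] at h3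
    omega
  by_contra! hlt
  have := key (g.toWord.countP p + g⁻¹.toWord.countP p + 1)
  nlinarith

theorem countP_eq_of_conj {u v : List (α × Bool)} (hu : IsCyclicallyReduced u)
    (hv : IsCyclicallyReduced v) {g : FreeGroup α} (h : mk u = g * mk v * g⁻¹)
    (p : α × Bool → Bool) : u.countP p = v.countP p := by
  classical
  refine le_antisymm (countP_le_of_conj hu h p hv) (countP_le_of_conj hv (g := g⁻¹) ?_ p hu)
  rw [h]; group

theorem take_prefix_toWord_mul [DecidableEq α] {u : List (α × Bool)} (hu : IsReduced u)
    (g : FreeGroup α) : u.take (u.length - g.norm) <+: (mk u * g).toWord := by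
  obtain ⟨p, q, r, h1, h2, h3⟩ := exists_toWord_mul (mk u) g
  rw [toWord_mk_of_isReduced hu] at h1
  rw [h3, h1]
  have hq : q.length ≤ g.norm := by
    rw [norm, h2]; simp
  refine List.IsPrefix.trans ?_ (List.prefix_append p r)
  rw [List.take_append_of_le_length (by rw [length_append]; omega)]
  exact List.take_prefix _ _

theorem getLast?_toWord_mul [DecidableEq α] {v : List (α × Bool)} (hv : IsReduced v)
    (g : FreeGroup α) (h : g.norm < v.length) : (g * mk v).toWord.getLast? = v.getLast? := by
  obtain ⟨p, q, r, h1, h2, h3⟩ := exists_toWord_mul g (mk v)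
  rw [toWord_mk_of_isReduced hv] at h2
  have hq : q.length ≤ g.norm := by
    rw [norm, h1]; simp
  have hr : r ≠ [] := by
    rintro rfl
    rw [h2] at h
    simp at h
    omega
  rw [h3, h2, List.getLast?_append_of_ne_nil _ hr, List.getLast?_append_of_ne_nil _ hr]

/-- In `u ^ N * g = g * v ^ N` the factor `g` spoils only a bounded number of letters at one end of
each side. So the reduced word begins like a power of `u`, and beyond a bounded part it is a power
of `v`. -/
theorem exists_prefix_wordPow {u v : List (α × Bool)} (hu : IsCyclicallyReduced u)
    (hv : IsCyclicallyReduced v) (hu0 : u ≠ []) (hv0 : v ≠ []) {g : FreeGroup α}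
    (h : mk u * g = g * mk v) :
    ∃ (n k : ℕ) (l : List (α × Bool)), mk l = mk u ^ n * g ∧ l ++ v <+: wordPow u k := by
  classical
  have hpow : ∀ n : ℕ, mk u ^ n * g = g * mk v ^ n := by
    intro n
    have : SemiconjBy g (mk v) (mk u) := h.symm
    exact (this.pow_right n).symm
  have hul : 0 < u.length := List.length_pos_iff.2 hu0
  have hvl : 0 < v.length := List.length_pos_iff.2 hv0
  -- With this many copies of `v`, `g` cannot cancel the last letter, so `l` ends like `v` and
  -- further copies of `v` attach without cancellation.
  set n := g.norm + 1 with hn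
  set l := (mk u ^ n * g).toWord with hl
  have hlast : l.getLast? = v.getLast? := by
    rw [hl, hpow, ← mk_wordPow, getLast?_toWord_mul (v := wordPow v n)
      (hv.flatten_replicate n).isReduced]
    · rw [wordPow, hn, List.replicate_succ', List.flatten_concat,
        List.getLast?_append_of_ne_nil _ hv0]
    · have := length_wordPow v n
      rw [wordPow] at this
      rw [wordPow, this]
      nlinarith
  -- One `g.norm` pays for the length of `l`, the other for the letters of the power of `u` that `g`
  -- may destroy; `v.length` makes room for `v`.
  set m := 2 * g.norm + v.length with hm
  have hred : IsReduced (l ++ wordPow v (m + 1)) := by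
    unfold IsReduced
    rw [List.isChain_append]
    refine ⟨isReduced_toWord, (hv.flatten_replicate _).isReduced, ?_⟩
    intro x hx y hy
    rw [hlast] at hx
    have : (wordPow v (m + 1)).head? = v.head? := by
      rw [wordPow, List.replicate_succ, List.flatten_cons, List.head?_append_of_ne_nil _ hv0]
    rw [this] at hy
    exact hv.2 x hx y hy
  have hword : (mk (wordPow u (n + (m + 1))) * g).toWord = l ++ wordPow v (m + 1) := by
    rw [← toWord_mk_of_isReduced hred, mk_wordPow, pow_add]
    congr 1
    rw [← mul_mk, hl, mk_toWord, mk_wordPow, mul_assoc, mul_assoc, hpow (m + 1)]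
  refine ⟨n, n + (m + 1), l, by rw [hl, mk_toWord], ?_⟩
  have h1 := take_prefix_toWord_mul (u := wordPow u (n + (m + 1)))
    (hu.flatten_replicate _).isReduced g
  rw [hword] at h1
  have h2 : l ++ v <+: l ++ wordPow v (m + 1) := by
    rw [List.prefix_append_right_inj, wordPow, List.replicate_succ, List.flatten_cons]
    exact List.prefix_append _ _
  refine List.IsPrefix.trans (List.prefix_of_prefix_length_le h2 h1 ?_) (List.take_prefix _ _)
  have h3 : l.length ≤ n * u.length + g.norm := by
    have := norm_mul_le (mk u ^ n) g
    unfold norm at this ⊢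
    rw [hu.toWord_pow, length_wordPow] at this
    exact this
  rw [List.length_take, length_wordPow, List.length_append]
  have : (n + (m + 1)) * u.length = n * u.length + m * u.length + u.length := by ring
  have : m ≤ m * u.length := Nat.le_mul_of_pos_right _ hul
  omega

end FreeGroup

/-! ### Words in `a`, `b` as lists of signs and gaps. -/

namespace FreeGroup

open List

/-- The letters of the power `b ^ k`. -/
def gapLetters (k : ℤ) : List (Fin 2 × Bool) := List.replicate k.natAbs (1, decide (0 ≤ k))

/-- The word `a^{e₁} b^{k₁} a^{e₂} b^{k₂} ⋯` coded by a list of pairs (sign `eᵢ`, gap `kᵢ`). -/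
def gapWord : List (Bool × ℤ) → List (Fin 2 × Bool)
  | [] => []
  | x :: l => (0, x.1) :: (gapLetters x.2 ++ gapWord l)

/-- Consecutive entries of a gap word fit if no cancellation takes place between them. -/
def GapFit (x y : Bool × ℤ) : Prop := x.1 ≠ y.1 → x.2 ≠ 0

@[simp] theorem gapWord_nil : gapWord [] = [] := rfl

theorem gapWord_cons (x : Bool × ℤ) (l : List (Bool × ℤ)) :
    gapWord (x :: l) = (0, x.1) :: (gapLetters x.2 ++ gapWord l) := rfl

theorem gapWord_append (l m : List (Bool × ℤ)) : gapWord (l ++ m) = gapWord l ++ gapWord m := by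
  induction l with
  | nil => rfl
  | cons x l ih => simp [gapWord_cons, ih]

theorem fst_of_mem_gapLetters {k : ℤ} {x : Fin 2 × Bool} (h : x ∈ gapLetters k) : x.1 = 1 := by
  rw [(List.mem_replicate.1 h).2]

theorem gapLetters_injective : Function.Injective gapLetters := by
  intro j k h
  have h1 := congrArg List.length h
  simp only [gapLetters, length_replicate] at h1
  rcases Nat.eq_zero_or_pos j.natAbs with h0 | h0
  · omega
  · obtain ⟨n, hn⟩ := Nat.exists_eq_add_of_lt h0
    have h2 := congrArg List.head? h
    have h3 : k.natAbs = n + 1 := by omega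
    have h4 : j.natAbs = n + 1 := by omega
    simp only [gapLetters, h3, h4, List.replicate_succ, head?_cons, Option.some.injEq,
      Prod.mk.injEq, true_and, decide_eq_decide] at h2
    omega

theorem wordPow_gapWord (l : List (Bool × ℤ)) (n : ℕ) :
    wordPow (gapWord l) n = gapWord (List.replicate n l).flatten := by
  induction n with
  | zero => rfl
  | succ n ih =>
    unfold wordPow at *
    rw [List.replicate_succ, List.flatten_cons, ih, List.replicate_succ, List.flatten_cons,
      gapWord_append]

theorem exists_of_gapWord_eq_append {l : List (Bool × ℤ)} {u v : List (Fin 2 × Bool)} {e : Bool}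
    (h : gapWord l = u ++ (0, e) :: v) :
    ∃ l₁ k l₂, l = l₁ ++ (e, k) :: l₂ ∧ u = gapWord l₁ ∧ v = gapLetters k ++ gapWord l₂ := by
  induction l generalizing u with
  | nil => simp at h
  | cons x l ih =>
    obtain ⟨e', k⟩ := x
    rw [gapWord_cons] at h
    rcases u with _ | ⟨y, u⟩
    · simp only [nil_append, cons.injEq, Prod.mk.injEq, true_and] at h
      obtain ⟨rfl, rfl⟩ := h
      exact ⟨[], k, l, rfl, rfl, rfl⟩
    · simp only [cons_append, cons.injEq] at h
      obtain ⟨rfl, h⟩ := h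
      have : ∃ c, u = gapLetters k ++ c ∧ gapWord l = c ++ (0, e) :: v := by
        rcases List.append_eq_append_iff.1 h with ⟨c, h1, h2⟩ | ⟨c, h1, h2⟩
        · exact ⟨c, h1, h2⟩
        · rcases c with _ | ⟨z, c⟩
          · exact ⟨[], by simpa using h1.symm, by simpa using h2.symm⟩
          · simp only [cons_append, cons.injEq] at h2
            have := fst_of_mem_gapLetters (k := k) (x := z) (by rw [h1]; simp)
            rw [← h2.1] at this
            simp at this
      obtain ⟨c, rfl, hc⟩ := this
      obtain ⟨l₁, j, l₂, rfl, rfl, rfl⟩ := ih hc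
      exact ⟨(e', k) :: l₁, j, l₂, rfl, rfl, rfl⟩

theorem takeWhile_gapWord (k : ℤ) (l : List (Bool × ℤ)) :
    (gapLetters k ++ gapWord l).takeWhile (fun x => x.1 = 1) = gapLetters k := by
  rw [List.takeWhile_append_of_pos]
  · cases l <;> simp [gapWord_cons]
  · intro x hx
    simpa using fst_of_mem_gapLetters hx

theorem takeWhile_gapLetters_append (k : ℤ) (e : Bool) (u : List (Fin 2 × Bool)) :
    (gapLetters k ++ (0, e) :: u).takeWhile (fun x => x.1 = 1) = gapLetters k := by
  rw [List.takeWhile_append_of_pos]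
  · simp
  · intro x hx
    simpa using fst_of_mem_gapLetters hx

/-- The next `a`-letter closes every gap of `m` except the last, which may continue into `u`; that
entry has to be dropped. -/
theorem dropLast_prefix_of_gapWord_eq_append {l m : List (Bool × ℤ)} {u : List (Fin 2 × Bool)}
    (h : gapWord l = gapWord m ++ u) : m.dropLast <+: l := by
  induction m generalizing l with
  | nil => simp
  | cons x m ih =>
    rcases m with _ | ⟨y, m⟩
    · simp
    · rcases l with _ | ⟨z, l⟩
      · simp [gapWord_cons] at h
      · obtain ⟨e, k⟩ := x
        obtain ⟨e', k'⟩ := z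
        rw [gapWord_cons, gapWord_cons (e, k)] at h
        simp only [cons_append, cons.injEq, Prod.mk.injEq, true_and, append_assoc] at h
        obtain ⟨rfl, h⟩ := h
        have hk : k' = k := by
          apply gapLetters_injective
          have := congrArg (List.takeWhile (fun x => x.1 = 1)) h
          rwa [takeWhile_gapWord, gapWord_cons, cons_append, takeWhile_gapLetters_append] at this
        subst hk
        have := ih (List.append_cancel_left h)
        rw [List.dropLast_cons_of_ne_nil (by simp)]
        rwa [List.prefix_cons_inj]

theorem exists_of_gapWord_eq_append₃ {l m : List (Bool × ℤ)} {u v : List (Fin 2 × Bool)}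
    (hm : m ≠ []) (h : gapWord l = u ++ gapWord m ++ v) :
    ∃ l₁ l₂, l = l₁ ++ m.dropLast ++ l₂ ∧ u = gapWord l₁ := by
  obtain ⟨⟨e, k⟩, m, rfl⟩ := List.exists_cons_of_ne_nil hm
  have h' := h
  rw [append_assoc, gapWord_cons, cons_append] at h
  obtain ⟨l₁, j, l₂, rfl, rfl, h2⟩ := exists_of_gapWord_eq_append h
  rw [gapWord_append, append_assoc] at h'
  obtain ⟨r, hr⟩ := dropLast_prefix_of_gapWord_eq_append (List.append_cancel_left h')
  exact ⟨l₁, r, by rw [append_assoc, hr], rfl⟩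

theorem isReduced_gapWord_append {l : List (Bool × ℤ)} {x : Bool × ℤ}
    (h : (l ++ [x]).IsChain GapFit) : IsReduced (gapWord l ++ [(0, x.1)]) := by
  induction l with
  | nil => simp
  | cons y l ih =>
    have h' : (l ++ [x]).IsChain GapFit := by
      rw [cons_append] at h
      exact h.tail
    specialize ih h'
    rw [gapWord_cons, cons_append, append_assoc]
    obtain ⟨z, m, hz, hyz⟩ : ∃ z m, gapWord l ++ [(0, x.1)] = (0, z) :: m ∧
        (y.1 ≠ z → y.2 ≠ 0) := by
      rcases l with _ | ⟨z, l⟩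
      · refine ⟨x.1, [], rfl, ?_⟩
        simpa [GapFit] using h
      · refine ⟨z.1, _, rfl, ?_⟩
        simp only [cons_append, isChain_cons_cons] at h
        exact h.1
    rw [hz] at ih ⊢
    rcases Nat.eq_zero_or_pos y.2.natAbs with h0 | h0
    · simp only [gapLetters, h0, replicate_zero, nil_append]
      rw [isReduced_cons_cons]
      refine ⟨fun _ => ?_, ih⟩
      by_contra hne
      exact hyz hne (by omega)
    · obtain ⟨n, hn⟩ : ∃ n, y.2.natAbs = n + 1 := ⟨y.2.natAbs - 1, by omega⟩
      unfold gapLetters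
      rw [hn]
      have : ∀ n : ℕ, IsReduced (List.replicate (n + 1) ((1 : Fin 2), decide (0 ≤ y.2)) ++
          (0, z) :: m) := by
        intro n
        induction n with
        | zero =>
          simp only [zero_add, replicate_one, singleton_append]
          rw [isReduced_cons_cons]
          exact ⟨by simp, ih⟩
        | succ n ihn =>
          rw [List.replicate_succ, List.replicate_succ] at *
          rw [cons_append, cons_append, isReduced_cons_cons]
          exact ⟨fun _ => rfl, ihn⟩
      have := this n
      rw [List.replicate_succ] at *
      rw [cons_append, isReduced_cons_cons]
      exact ⟨by simp, this⟩

theorem isCyclicallyReduced_gapWord {x : Bool × ℤ} {l : List (Bool × ℤ)}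
    (h : (x :: l ++ [x]).IsChain GapFit) : IsCyclicallyReduced (gapWord (x :: l)) := by
  have := isReduced_gapWord_append h
  refine ⟨this.infix ⟨[], [(0, x.1)], by simp⟩, ?_⟩
  intro y hy z hz
  unfold IsReduced at this
  rw [List.isChain_append] at this
  rw [gapWord_cons, head?_cons, Option.mem_def, Option.some.injEq] at hz
  subst hz
  exact this.2.2 y hy _ (by simp)

/-- `exists_prefix_wordPow` read at the level of gaps: the copy of the second word starts with an
`a`-letter, hence at an entry of the list. -/
theorem exists_gapWord_infix {x y : Bool × ℤ} {l m : List (Bool × ℤ)}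
    (hl : (x :: l ++ [x]).IsChain GapFit) (hm : (y :: m ++ [y]).IsChain GapFit)
    {g : FreeGroup (Fin 2)}
    (h : mk (gapWord (x :: l)) * g = g * mk (gapWord (y :: m))) :
    ∃ (n k : ℕ) (l₁ l₂ : List (Bool × ℤ)), mk (gapWord l₁) = mk (gapWord (x :: l)) ^ n * g ∧
      (List.replicate k (x :: l)).flatten = l₁ ++ (y :: m).dropLast ++ l₂ := by
  obtain ⟨n, k, u, hu, v, hv⟩ := exists_prefix_wordPow (isCyclicallyReduced_gapWord hl)
    (isCyclicallyReduced_gapWord hm) (by simp [gapWord_cons]) (by simp [gapWord_cons]) h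
  rw [wordPow_gapWord] at hv
  obtain ⟨l₁, l₂, h1, rfl⟩ := exists_of_gapWord_eq_append₃ (by simp) hv.symm
  exact ⟨n, k, l₁, l₂, hu, h1⟩

end FreeGroup

/-! ### Synchronising codes: freeness and malnormality. -/

namespace FreeGroup

open List

theorem exists_conj_cyclicallyReduced {ι : Type*} [DecidableEq ι] {f : FreeGroup ι} (hf : f ≠ 1) :
    ∃ q s l, IsCyclicallyReduced (s :: l) ∧ f = q * mk (s :: l) * q⁻¹ := by
  have h1 := reduceCyclically.isCyclicallyReduced (isReduced_toWord (x := f))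
  have h2 := congrArg mk (reduceCyclically.conj_conjugator_reduceCyclically f.toWord)
  rw [mk_toWord, ← mul_mk, ← mul_mk, ← inv_mk] at h2
  rcases hc : reduceCyclically f.toWord with _ | ⟨s, l⟩
  · rw [hc] at h2
    rw [← one_eq_mk, mul_one, mul_inv_cancel] at h2
    exact absurd h2.symm hf
  · rw [hc] at h1 h2
    exact ⟨_, s, l, h1, h2.symm⟩

/-- A family `w` of elements of `F(a, b)` whose products, up to bounded corrections `pre`, are
coded by gap words in which the beginning of each factor can be recognised. -/
structure SyncCode (ι : Type) where
  ofData ::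
  w : ι → FreeGroup (Fin 2)
  pre : ι × Bool → FreeGroup (Fin 2)
  head : ι × Bool → Bool × ℤ
  tail : ι × Bool → ι × Bool → List (Bool × ℤ)
  mk_gapWord : ∀ s t, (s.1 = t.1 → s.2 = t.2) →
    mk (gapWord (head s :: tail s t)) = (pre s)⁻¹ * lift w (mk [s]) * pre t
  tail_ne_nil : ∀ s t, tail s t ≠ []
  head_injective : Function.Injective head
  head_notMem_tail : ∀ s t u, (s.1 = t.1 → s.2 = t.2) → head u ∉ tail s t
  isChain : ∀ s t, (s.1 = t.1 → s.2 = t.2) → (head s :: tail s t ++ [head t]).IsChain GapFit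

namespace SyncCode

variable {ι : Type} (S : SyncCode ι)

/-- The coding of a word, given the letter that follows it. -/
def code : List (ι × Bool) → ι × Bool → List (Bool × ℤ)
  | [], _ => []
  | s :: l, z => S.head s :: (S.tail s (l.headD z) ++ code l z)

theorem code_cons (s : ι × Bool) (l : List (ι × Bool)) (z : ι × Bool) :
    S.code (s :: l) z = S.head s :: (S.tail s (l.headD z) ++ S.code l z) := rfl

theorem headD_rel {s z : ι × Bool} {l : List (ι × Bool)} (h : IsReduced (s :: l ++ [z])) :
    s.1 = (l.headD z).1 → s.2 = (l.headD z).2 := by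
  rcases l with _ | ⟨t, l⟩
  · exact (isReduced_cons_cons.1 h).1
  · exact (isReduced_cons_cons.1 h).1

theorem isReduced_of_cons {s : ι × Bool} {l : List (ι × Bool)} (h : IsReduced (s :: l)) :
    IsReduced l := h.infix ⟨[s], [], by simp⟩

theorem mk_gapWord_code {l : List (ι × Bool)} {z : ι × Bool} (h : IsReduced (l ++ [z])) :
    mk (gapWord (S.code l z)) = (S.pre (l.headD z))⁻¹ * lift S.w (mk l) * S.pre z := by
  induction l with
  | nil =>
    have : (mk [] : FreeGroup ι) = 1 := rfl
    simp [code, ← one_eq_mk]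
  | cons s l ih =>
    rw [code_cons, ← cons_append, gapWord_append, ← mul_mk, ih (isReduced_of_cons h),
      S.mk_gapWord _ _ (headD_rel h)]
    have : (mk (s :: l) : FreeGroup ι) = mk [s] * mk l := by rw [mul_mk]; rfl
    rw [this, _root_.map_mul, List.headD_cons]
    group

theorem headD_code (l : List (ι × Bool)) (z : ι × Bool) :
    (S.code l z ++ [S.head z]).head? = some (S.head (l.headD z)) := by
  cases l <;> rfl

theorem isChain_code {l : List (ι × Bool)} {z : ι × Bool} (h : IsReduced (l ++ [z])) :
    (S.code l z ++ [S.head z]).IsChain GapFit := by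
  induction l with
  | nil => simp [code]
  | cons s l ih =>
    have h1 := ih (isReduced_of_cons h)
    have h2 := S.isChain _ _ (headD_rel h)
    rw [code_cons, ← cons_append, append_assoc]
    obtain ⟨r, hr⟩ : ∃ r, S.code l z ++ [S.head z] = [S.head (l.headD z)] ++ r := by
      have := S.headD_code l z
      rcases hc : S.code l z ++ [S.head z] with _ | ⟨c, r⟩
      · simp at hc
      · rw [hc] at this
        simp only [head?_cons, Option.some.injEq] at this
        exact ⟨r, by rw [this]; rfl⟩
    rw [hr] at h1 ⊢
    rw [← append_assoc]
    exact h2.append_overlap h1 (by simp)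

theorem code_append (l m : List (ι × Bool)) (z : ι × Bool) :
    S.code (l ++ m) z = S.code l (m.headD z) ++ S.code m z := by
  induction l with
  | nil => rfl
  | cons s l ih =>
    rw [cons_append, code_cons, ih, code_cons, cons_append, append_assoc]
    congr 3
    cases l <;> rfl

theorem code_replicate (s : ι × Bool) (l : List (ι × Bool)) (k : ℕ) :
    S.code (List.replicate k (s :: l)).flatten s =
      (List.replicate k (S.code (s :: l) s)).flatten := by
  induction k with
  | zero => rfl
  | succ k ih =>
    rw [List.replicate_succ, List.flatten_cons, List.replicate_succ, List.flatten_cons, code_append,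
      ih]
    congr 2
    cases k <;> simp [List.replicate_succ]

/-- Synchronisation: a head lies in no tail, so an occurrence of one marks the start of a factor,
and by injectivity of `head` it names that letter. -/
theorem exists_of_code_eq {l : List (ι × Bool)} {z t : ι × Bool} (h : IsReduced (l ++ [z]))
    {m₁ m₂ : List (Bool × ℤ)} (hm : S.code l z = m₁ ++ S.head t :: m₂) :
    ∃ l₁ l₂, l = l₁ ++ t :: l₂ ∧ m₁ = S.code l₁ t := by
  induction l generalizing m₁ with
  | nil => simp [code] at hm
  | cons s l ih =>
    rw [code_cons] at hm
    rcases m₁ with _ | ⟨x, m₁⟩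
    · simp only [nil_append, cons.injEq] at hm
      obtain rfl := S.head_injective hm.1
      exact ⟨[], l, rfl, rfl⟩
    · simp only [cons_append, cons.injEq] at hm
      obtain ⟨rfl, hm⟩ := hm
      have hn := S.head_notMem_tail s (l.headD z) t (headD_rel h)
      have : ∃ c, m₁ = S.tail s (l.headD z) ++ c ∧ S.code l z = c ++ S.head t :: m₂ := by
        rcases List.append_eq_append_iff.1 hm with ⟨c, h1, h2⟩ | ⟨c, h1, h2⟩
        · exact ⟨c, h1, h2⟩
        · rcases c with _ | ⟨y, c⟩
          · exact ⟨[], by simpa using h1.symm, by simpa using h2.symm⟩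
          · simp only [cons_append, cons.injEq] at h2
            rw [h1, ← h2.1] at hn
            simp at hn
      obtain ⟨c, rfl, hc⟩ := this
      obtain ⟨l₁, l₂, rfl, rfl⟩ := ih (isReduced_of_cons h) hc
      refine ⟨s :: l₁, l₂, rfl, ?_⟩
      rw [code_cons]
      congr 3
      cases l₁ <;> rfl

theorem isReduced_append_head {s : ι × Bool} {l : List (ι × Bool)}
    (h : IsCyclicallyReduced (s :: l)) : IsReduced (s :: l ++ [s]) := by
  unfold IsReduced
  rw [List.isChain_append]
  refine ⟨h.1, by simp, ?_⟩
  intro x hx y hy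
  refine h.2 x hx y ?_
  simpa using hy

theorem isChain_code_append {s : ι × Bool} {l : List (ι × Bool)}
    (h : IsCyclicallyReduced (s :: l)) :
    (S.head s :: (S.tail s (l.headD s) ++ S.code l s) ++ [S.head s]).IsChain GapFit :=
  S.isChain_code (isReduced_append_head h)

theorem lift_mk_eq {s : ι × Bool} {l : List (ι × Bool)} (h : IsCyclicallyReduced (s :: l)) :
    lift S.w (mk (s :: l)) =
      S.pre s * mk (gapWord (S.code (s :: l) s)) * (S.pre s)⁻¹ := by
  rw [S.mk_gapWord_code (isReduced_append_head h), List.headD_cons]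
  group

/-- A nontrivial element is conjugate to a cyclically reduced word, whose image is conjugate to a
nonempty reduced gap word. -/
theorem lift_injective : Function.Injective (lift S.w) := by
  classical
  rw [injective_iff_map_eq_one]
  intro f hf
  by_contra hne
  obtain ⟨q, s, l, hc, rfl⟩ := exists_conj_cyclicallyReduced hne
  rw [_root_.map_mul, _root_.map_mul, _root_.map_inv, S.lift_mk_eq hc] at hf
  have : mk (gapWord (S.code (s :: l) s)) = 1 := by
    have h2 : lift S.w q * S.pre s * mk (gapWord (S.code (s :: l) s)) *
      (lift S.w q * S.pre s)⁻¹ = 1 := by rw [← hf]; group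
    exact conj_eq_one_iff.1 h2
  have h3 := toWord_mk_of_isReduced (isCyclicallyReduced_gapWord (S.isChain_code_append hc)).1
  rw [← code_cons, this, toWord_one, code_cons, gapWord_cons] at h3
  simp at h3

/-- The code of `t :: m` occurs inside a power of the code of `s :: l` and starts with the head of
`t`. What precedes it is therefore the code of a word `m₁`, and `g` is expressed through `m₁` and a
power of `s :: l`. -/
theorem pre_mul_pre_inv_mem {s t : ι × Bool} {l m : List (ι × Bool)}
    (hs : IsCyclicallyReduced (s :: l)) (ht : IsCyclicallyReduced (t :: m))
    {g : FreeGroup (Fin 2)}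
    (h : mk (gapWord (S.code (s :: l) s)) * g = g * mk (gapWord (S.code (t :: m) t))) :
    S.pre s * g * (S.pre t)⁻¹ ∈ (lift S.w).range := by
  obtain ⟨n, k, l₁, l₂, h1, h2⟩ := exists_gapWord_infix (S.isChain_code_append hs)
    (S.isChain_code_append ht) h
  -- Since tails are nonempty, the lost last entry is not the head of `t`.
  have hne : S.tail t (m.headD t) ++ S.code m t ≠ [] := by simp [S.tail_ne_nil]
  rw [← code_cons, ← code_replicate, List.dropLast_cons_of_ne_nil hne, append_assoc,
    cons_append] at h2
  have hred : IsReduced ((List.replicate k (s :: l)).flatten ++ [s]) := by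
    have := (hs.flatten_replicate (k + 1)).isReduced
    rw [List.replicate_succ', List.flatten_concat] at this
    exact this.infix ⟨[], l, by simp⟩
  obtain ⟨m₁, m₂, h3, rfl⟩ := S.exists_of_code_eq hred h2
  rw [h3] at hred
  have hred' : IsReduced (m₁ ++ [t]) := hred.infix ⟨[], m₂ ++ [s], by simp⟩
  have hhead : m₁.headD t = s := by
    rcases k with _ | k
    · simp at h3
    · rw [List.replicate_succ, List.flatten_cons] at h3
      cases m₁ <;> simp at h3 ⊢ <;> simp [h3.1]
  rw [S.mk_gapWord_code hred', hhead, ← code_cons, S.mk_gapWord_code (isReduced_append_head hs),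
    List.headD_cons] at h1
  refine ⟨mk (s :: l) ^ (-(n : ℤ)) * mk m₁, ?_⟩
  rw [_root_.map_mul, map_zpow]
  have h4 : (S.pre s)⁻¹ * lift S.w (mk (s :: l)) * S.pre s =
      (S.pre s)⁻¹ * lift S.w (mk (s :: l)) * ((S.pre s)⁻¹)⁻¹ := by group
  rw [h4, conj_pow] at h1
  have h5 : lift S.w (mk m₁) =
      lift S.w (mk (s :: l)) ^ n * (S.pre s * g * (S.pre t)⁻¹) := by
    calc lift S.w (mk m₁) = S.pre s * ((S.pre s)⁻¹ * lift S.w (mk m₁) * S.pre t) * (S.pre t)⁻¹ := by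
          group
      _ = _ := by rw [h1]; group
  rw [h5, zpow_neg, zpow_natCast]
  group

/-- The subgroup coded by a synchronising code is malnormal. -/
theorem malnormal {f₁ f₂ : FreeGroup ι} (hf : f₁ ≠ 1) {g : FreeGroup (Fin 2)}
    (h : lift S.w f₁ * g = g * lift S.w f₂) : g ∈ (lift S.w).range := by
  classical
  have hf₂ : f₂ ≠ 1 := by
    rintro rfl
    apply hf
    apply S.lift_injective
    rw [_root_.map_one] at h ⊢
    simpa using h
  obtain ⟨p, s, l, hs, rfl⟩ := exists_conj_cyclicallyReduced hf
  obtain ⟨q, t, m, ht, rfl⟩ := exists_conj_cyclicallyReduced hf₂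
  simp only [_root_.map_mul, _root_.map_inv, S.lift_mk_eq hs, S.lift_mk_eq ht] at h
  have := S.pre_mul_pre_inv_mem hs ht
    (g := (S.pre s)⁻¹ * (lift S.w p)⁻¹ * g * lift S.w q * S.pre t) (by
      generalize mk (gapWord (S.code (s :: l) s)) = u at *
      generalize mk (gapWord (S.code (t :: m) t)) = v at *
      calc _ = (S.pre s)⁻¹ * (lift S.w p)⁻¹ * (lift S.w p * (S.pre s * u * (S.pre s)⁻¹) *
            (lift S.w p)⁻¹ * g) * lift S.w q * S.pre t := by group
        _ = _ := by rw [h]; group)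
  have h2 := (lift S.w).range.mul_mem ((lift S.w).range.mul_mem ⟨p, rfl⟩ this)
    ((lift S.w).range.inv_mem ⟨q, rfl⟩)
  convert h2 using 1
  group

end SyncCode

end FreeGroup

/-! ### A malnormal free subgroup of any countable rank. -/

namespace FreeGroup

open List

theorem mk_gapLetters (k : ℤ) : mk (gapLetters k) = (of (1 : Fin 2)) ^ k := by
  unfold gapLetters
  have h : ∀ (n : ℕ) (e : Bool), (mk (List.replicate n ((1 : Fin 2), e))) = mk [(1, e)] ^ n := by
    intro n e
    rw [pow_mk]
    congr 1
    induction n with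
    | zero => rfl
    | succ n ih => simp [List.replicate_succ]
  rw [h]
  rcases le_or_gt 0 k with hk | hk
  · obtain ⟨n, rfl⟩ := Int.eq_ofNat_of_zero_le hk
    simp [of]
  · obtain ⟨n, rfl⟩ := Int.exists_eq_neg_ofNat hk.le
    have : decide (0 ≤ -(n : ℤ)) = false := decide_eq_false (not_le.2 hk)
    rw [this]
    have h2 : (mk [((1 : Fin 2), false)]) = (of 1)⁻¹ := rfl
    rw [h2]
    simp

theorem mk_gapWord_cons (x : Bool × ℤ) (l : List (Bool × ℤ)) :
    mk (gapWord (x :: l)) =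
      (if x.1 then of (0 : Fin 2) else (of 0)⁻¹) * of 1 ^ x.2 * mk (gapWord l) := by
  rw [gapWord_cons, ← mk_gapLetters]
  rcases x with ⟨_ | _, k⟩
  · have : (of (0 : Fin 2))⁻¹ = mk [(0, false)] := rfl
    simp [this]
  · simp [of]

theorem mk_gapWord_nil : mk (gapWord []) = 1 := rfl

theorem lift_mk_singleton {ι G : Type*} [Group G] (w : ι → G) (i : ι) (e : Bool) :
    lift w (mk [(i, e)]) = if e then w i else (w i)⁻¹ := by
  cases e <;> simp

/-- The sign of a letter. -/
def sgn (e : Bool) : ℤ := if e then 1 else -1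

@[simp] theorem sgn_true : sgn true = 1 := rfl
@[simp] theorem sgn_false : sgn false = -1 := rfl

/-- The elements `b^{2n} a b^{2n+1} a b^{2n}` of `F(a, b)`. -/
def oddElement (n : ℕ) : FreeGroup (Fin 2) :=
  of 1 ^ (2 * n : ℤ) * of 0 * of 1 ^ (2 * n + 1 : ℤ) * of 0 * of 1 ^ (2 * n : ℤ)

/-- Distinct elements `b^{2n} a b^{2n+1} a b^{2n}` form a synchronising code. -/
def oddCode {ι : Type} (f : ι → ℕ) (hf : Function.Injective f) : SyncCode ι where
  w i := oddElement (f i)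
  pre s := of 1 ^ (2 * sgn s.2 * f s.1)
  head s := (s.2, sgn s.2 * (2 * f s.1 + 1))
  tail s t := [(s.2, 2 * (sgn s.2 * f s.1 + sgn t.2 * f t.1))]
  mk_gapWord := by
    rintro ⟨i, _ | _⟩ ⟨j, _ | _⟩ - <;>
    simp only [mk_gapWord_cons, mk_gapWord_nil, lift_mk_singleton, sgn_true, sgn_false, oddElement,
      if_true, Bool.false_eq_true, if_false] <;> group
  tail_ne_nil := by simp
  head_injective := by
    rintro ⟨i, _ | _⟩ ⟨j, _ | _⟩ h <;> simp at h ⊢ <;> exact hf h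
  -- Gaps in heads are odd, gaps in tails are even.
  head_notMem_tail := by
    rintro ⟨i, _ | _⟩ ⟨j, _ | _⟩ ⟨k, _ | _⟩ - <;> simp <;> omega
  -- A gap between opposite signs vanishes only if `f i = f j`, that is, when a letter meets its
  -- inverse.
  isChain := by
    rintro ⟨i, _ | _⟩ ⟨j, _ | _⟩ h <;> simp only [cons_append, nil_append, isChain_cons_cons,
      isChain_singleton, GapFit, sgn_true, sgn_false] <;> refine ⟨by simp, ?_, trivial⟩ <;>
      simp <;> intro h1
    · have : f i = f j := by omega
      simpa using h (hf this)
    · have : f i = f j := by omega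
      simpa using h (hf this)

end FreeGroup

/-! ### The generators `ω_x`, `ω_y` form a synchronising code. -/

namespace SeedSubgroup

open List

open FreeGroup

theorem block_zero (s : ℕ) : block s 0 = 1 := rfl

theorem block_succ (s n : ℕ) : block s (n + 1) = block s n * (a ^ 3 * b ^ (s + n)) := by
  simp [block, List.range_succ]

theorem block_succ' (s n : ℕ) : block s (n + 1) = a ^ 3 * b ^ s * block (s + 1) n := by
  induction n with
  | zero => simp [block_succ, block_zero]
  | succ n ih =>
    rw [block_succ, ih, block_succ, show s + (n + 1) = s + 1 + n by ring]
    group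

/-- The entries coding `a^e b^k a^{2e}`. -/
def triple (e : Bool) (k : ℤ) : List (Bool × ℤ) := [(e, k), (e, 0), (e, 0)]

theorem mk_gapWord_append (l m : List (Bool × ℤ)) :
    mk (gapWord (l ++ m)) = mk (gapWord l) * mk (gapWord m) := by
  rw [gapWord_append, mul_mk]

theorem mk_gapWord_triple_true (k : ℤ) :
    mk (gapWord (triple true k)) = a * b ^ k * a ^ 2 := by
  simp only [triple, mk_gapWord_cons, mk_gapWord_nil, if_true]
  change a * b ^ k * (a * b ^ (0 : ℤ) * (a * b ^ (0 : ℤ) * 1)) = _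
  simp only [zpow_zero, mul_one, pow_two, mul_assoc]

theorem mk_gapWord_triple_false (k : ℤ) :
    mk (gapWord (triple false k)) = a⁻¹ * b ^ k * (a ^ 2)⁻¹ := by
  simp only [triple, mk_gapWord_cons, mk_gapWord_nil, Bool.false_eq_true, if_false]
  change a⁻¹ * b ^ k * (a⁻¹ * b ^ (0 : ℤ) * (a⁻¹ * b ^ (0 : ℤ) * 1)) = _
  group

/-- The middle part of the code of a positive generator. -/
def ascending (s n : ℕ) : List (Bool × ℤ) :=
  (List.range n).flatMap fun j : ℕ => triple true (s + j)

/-- The middle part of the code of a negative generator. -/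
def descending (s n : ℕ) : List (Bool × ℤ) :=
  (List.range n).flatMap fun j : ℕ => triple false (-(s + n - 1 - j))

theorem ascending_succ (s n : ℕ) : ascending s (n + 1) = ascending s n ++ triple true (s + n) := by
  simp [ascending, List.range_succ]

theorem descending_succ (s n : ℕ) :
    descending s (n + 1) = triple false (-(s + n)) ++ descending s n := by
  rw [descending, List.range_succ_eq_map, List.flatMap_cons, List.flatMap_map]
  unfold descending
  push_cast
  congr 2
  · ring
  · funext j
    congr 1
    ring

theorem mk_gapWord_ascending (s n : ℕ) :
    mk (gapWord (ascending s n)) = (a ^ 2)⁻¹ * block s n * a ^ 2 := by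
  induction n with
  | zero => simp [ascending, ← one_eq_mk, block_zero]
  | succ n ih =>
    rw [ascending_succ, mk_gapWord_append, ih, mk_gapWord_triple_true, block_succ]
    have : b ^ ((s : ℤ) + n) = b ^ (s + n) := by exact_mod_cast zpow_natCast b (s + n)
    rw [this]
    group

theorem mk_gapWord_descending (s n : ℕ) :
    mk (gapWord (descending s n)) = a⁻¹ * (block s n)⁻¹ * a := by
  induction n with
  | zero => simp [descending, ← one_eq_mk, block_zero]
  | succ n ih =>
    rw [descending_succ, mk_gapWord_append, ih, mk_gapWord_triple_false, block_succ]
    have : b ^ (-((s : ℤ) + n)) = (b ^ (s + n))⁻¹ := by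
      rw [zpow_neg]; exact_mod_cast congrArg _ (zpow_natCast b (s + n))
    rw [this]
    group

/-- The first exponent of `b` in the generators, for `ρ = r + 3`. -/
def start (r : ℕ) (i : Fin 2) : ℕ := if i = 0 then 3 else r + 6

/-- The entries between the recognisable parts of two consecutive generators. -/
def junction (r : ℕ) (s t : Fin 2 × Bool) : List (Bool × ℤ) :=
  match s.2, t.2 with
  | true, true => triple true (start r s.1 + r + 2) ++ triple true (start r t.1)
  | true, false => [(true, start r s.1 - start r t.1), (false, 0), (false, 0)]
  | false, false => triple false (-start r s.1) ++ triple false (-(start r t.1 + r + 2))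
  | false, true => [(false, start r t.1 - start r s.1), (true, 0), (true, 0)]

/-- The middle part of the code of a generator. -/
def middle (r : ℕ) (s : Fin 2 × Bool) : List (Bool × ℤ) :=
  if s.2 then ascending (start r s.1 + 2) r else descending (start r s.1 + 1) r

/-- The first gap of the code of a generator. -/
def headGap (r : ℕ) (s : Fin 2 × Bool) : ℤ :=
  if s.2 then start r s.1 + 1 else -(start r s.1 + r + 1)

theorem fst_of_mem_middle {r : ℕ} {s : Fin 2 × Bool} {x : Bool × ℤ} (h : x ∈ middle r s) :
    x.1 = s.2 := by
  rcases s with ⟨i, _ | _⟩ <;> simp [middle, ascending, descending, triple] at h <;>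
    obtain ⟨j, -, rfl | rfl⟩ := h <;> rfl

theorem isChain_append_of_fst_eq {e : Bool} {l m : List (Bool × ℤ)} {y : Bool × ℤ}
    (hl : ∀ x ∈ l, x.1 = e) (hy : y.1 = e) (h : (y :: m).IsChain GapFit) :
    (l ++ y :: m).IsChain GapFit := by
  induction l with
  | nil => simpa using h
  | cons x l ih =>
    have h1 := ih fun z hz => hl z (by simp [hz])
    have hx := hl x (by simp)
    rcases l with _ | ⟨z, l⟩
    · simp only [nil_append, cons_append, isChain_cons_cons]
      exact ⟨fun hne => absurd (hx.trans hy.symm) hne, h⟩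
    · simp only [cons_append, isChain_cons_cons] at h1 ⊢
      exact ⟨fun hne => absurd (hx.trans (hl z (by simp)).symm) hne, h1⟩

theorem start_ne {r : ℕ} {i j : Fin 2} (h : i ≠ j) : start r i ≠ start r j := by
  fin_cases i <;> fin_cases j <;> simp_all [start]

/-- Signs are constant inside a factor, so only the junction of factors of opposite sign matters.
The gap there is a difference of the two starts, and it is nonzero because the generators differ. -/
theorem isChain_seed (r : ℕ) (s t : Fin 2 × Bool) (h : s.1 = t.1 → s.2 = t.2) :
    ((s.2, headGap r s) :: ([(s.2, 0), (s.2, 0)] ++ middle r s ++ junction r s t) ++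
      [(t.2, headGap r t)]).IsChain GapFit := by
  have key : ∀ y m, junction r s t ++ [(t.2, headGap r t)] = y :: m → y.1 = s.2 →
      (y :: m).IsChain GapFit → ((s.2, headGap r s) :: ([(s.2, 0), (s.2, 0)] ++ middle r s ++
        junction r s t) ++ [(t.2, headGap r t)]).IsChain GapFit := by
    intro y m hy hys hc
    have := isChain_append_of_fst_eq (e := s.2) (y := y) (m := m)
      (l := (s.2, headGap r s) :: ([(s.2, 0), (s.2, 0)] ++ middle r s)) (by
        intro x hx
        simp only [cons_append, nil_append, mem_cons] at hx
        rcases hx with rfl | rfl | rfl | hx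
        · rfl
        · rfl
        · rfl
        · exact fst_of_mem_middle hx) hys hc
    rw [← hy] at this
    simpa using this
  rcases s with ⟨i, _ | _⟩ <;> rcases t with ⟨j, _ | _⟩ <;>
    refine key _ _ rfl rfl ?_ <;> simp [GapFit, triple]
  · have := start_ne (r := r) (i := i) (j := j) (by rintro rfl; simp at h)
    omega
  · have := start_ne (r := r) (i := i) (j := j) (by rintro rfl; simp at h)
    omega

theorem block_add_three (s r : ℕ) : block s (r + 3) =
    a ^ 3 * b ^ s * (a ^ 3 * b ^ (s + 1)) * block (s + 2) r * (a ^ 3 * b ^ (s + r + 2)) := by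
  rw [block_succ, block_succ', block_succ', show s + (r + 2) = s + r + 2 by ring]
  group

theorem block_add_three' (s r : ℕ) : block s (r + 3) =
    a ^ 3 * b ^ s * block (s + 1) r * (a ^ 3 * b ^ (s + r + 1)) * (a ^ 3 * b ^ (s + r + 2)) := by
  rw [block_succ, block_succ, block_succ', show s + (r + 2) = s + r + 2 by ring,
    show s + (r + 1) = s + r + 1 by ring]

theorem mk_gapWord_seed_true (r : ℕ) (i : Fin 2) :
    mk (gapWord (triple true (headGap r (i, true)) ++ middle r (i, true))) =
      (a ^ 3 * b ^ start r i * a ^ 2)⁻¹ * block (start r i) (r + 3) *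
        (a * b ^ (start r i + r + 2))⁻¹ := by
  have h : headGap r (i, true) = ((start r i + 1 : ℕ) : ℤ) := by simp [headGap]
  rw [mk_gapWord_append, mk_gapWord_triple_true, h, zpow_natCast, block_add_three]
  simp only [middle, if_true]
  rw [mk_gapWord_ascending]
  generalize block (start r i + 2) r = c
  generalize b ^ (start r i + 1) = x
  generalize b ^ (start r i + r + 2) = y
  generalize b ^ (start r i) = z
  group

theorem mk_gapWord_seed_false (r : ℕ) (i : Fin 2) :
    mk (gapWord (triple false (headGap r (i, false)) ++ middle r (i, false))) =
      a ^ 2 * b ^ (start r i + r + 2) * (block (start r i) (r + 3))⁻¹ *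
        (a ^ 3 * b ^ start r i * a) := by
  have h : headGap r (i, false) = -((start r i + r + 1 : ℕ) : ℤ) := by simp [headGap]
  rw [mk_gapWord_append, mk_gapWord_triple_false, h, zpow_neg, zpow_natCast, block_add_three']
  simp only [middle, Bool.false_eq_true, if_false]
  rw [mk_gapWord_descending]
  generalize block (start r i + 1) r = c
  generalize b ^ (start r i + r + 1) = x
  generalize b ^ (start r i + r + 2) = y
  generalize b ^ (start r i) = z
  group

/-- The generators `ω_x`, `ω_y` of `L ρ` form a synchronising code. -/
def seedCode (r : ℕ) (hr : 2 ≤ r) : SyncCode (Fin 2) where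
  w i := block (start r i) (r + 3)
  -- Each factor is cut just before the last `a`-letter preceding its second `b`-syllable.
  -- Cancellation with the previous factor never reaches that point, so the head depends on `s`
  -- alone.
  pre s := if s.2 then a ^ 3 * b ^ start r s.1 * a ^ 2
    else (b ^ (start r s.1 + r + 2))⁻¹ * (a ^ 2)⁻¹
  head s := (s.2, headGap r s)
  tail s t := [(s.2, 0), (s.2, 0)] ++ middle r s ++ junction r s t
  mk_gapWord := by
    rintro ⟨i, e⟩ ⟨j, e'⟩ -
    have h : (e, headGap r (i, e)) :: ([(e, (0 : ℤ)), (e, 0)] ++ middle r (i, e) ++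
        junction r (i, e) (j, e')) = triple e (headGap r (i, e)) ++ middle r (i, e) ++
        junction r (i, e) (j, e') := by simp [triple]
    rw [h, mk_gapWord_append]
    rcases e with _ | _
    · rw [mk_gapWord_seed_false]
      rcases e' with _ | _ <;>
      simp only [lift_mk_singleton, if_true, Bool.false_eq_true, if_false, junction,
        mk_gapWord_append, mk_gapWord_triple_false, mk_gapWord_cons,
        mk_gapWord_nil] <;>
      simp only [← zpow_natCast, Nat.cast_add, Nat.cast_ofNat, ← show a = of 0 from rfl,
        ← show b = of 1 from rfl] <;> group
      simp only [zpow_two, mul_assoc]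
    · rw [mk_gapWord_seed_true]
      rcases e' with _ | _ <;>
      simp only [lift_mk_singleton, if_true, Bool.false_eq_true, if_false, junction,
        mk_gapWord_append, mk_gapWord_triple_true, mk_gapWord_cons,
        mk_gapWord_nil] <;>
      simp only [← zpow_natCast, Nat.cast_add, Nat.cast_ofNat, ← show a = of 0 from rfl,
        ← show b = of 1 from rfl] <;> group
  tail_ne_nil := by simp
  head_injective := by
    rintro ⟨i, _ | _⟩ ⟨j, _ | _⟩ h <;> fin_cases i <;> fin_cases j <;>
      simp [headGap, start] at h ⊢ <;> omega
  -- The junctions of opposite signs have gaps `±(r + 3)`, which would meet the head gap `4` if `r =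
  -- 1`; this is excluded by `2 ≤ r`.
  head_notMem_tail := by
    rintro ⟨i, _ | _⟩ ⟨j, _ | _⟩ ⟨k, _ | _⟩ h <;> fin_cases i <;> fin_cases j <;> fin_cases k <;>
      simp [headGap, start, middle, junction, ascending, descending, triple] at h ⊢
    all_goals and_intros <;> omega
  isChain := isChain_seed r

end SeedSubgroup

/-! ### Gromov products and length-preserving automorphisms. -/

namespace FreeGroup

open List

/-- The length of the longest common prefix of two lists. -/
def commonPrefix {β : Type*} [DecidableEq β] : List β → List β → ℕ
  | x :: l, y :: m => if x = y then commonPrefix l m + 1 else 0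
  | _, _ => 0

section commonPrefix

variable {β : Type*} [DecidableEq β]

theorem commonPrefix_comm (l m : List β) : commonPrefix l m = commonPrefix m l := by
  induction l generalizing m with
  | nil => cases m <;> rfl
  | cons x l ih =>
    cases m with
    | nil => rfl
    | cons y m => simp only [commonPrefix, eq_comm (a := x), ih]

theorem min_commonPrefix_le (l m k : List β) :
    min (commonPrefix l m) (commonPrefix m k) ≤ commonPrefix l k := by
  induction l generalizing m k with
  | nil => cases m <;> simp [commonPrefix]
  | cons x l ih =>
    rcases m with _ | ⟨y, m⟩
    · simp [commonPrefix]
    · rcases k with _ | ⟨z, k⟩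
      · simp [commonPrefix]
      · have := ih m k
        simp only [commonPrefix]
        split_ifs <;> simp_all

theorem exists_eq_append_commonPrefix (l m : List β) :
    ∃ c l' m', l = c ++ l' ∧ m = c ++ m' ∧ c.length = commonPrefix l m ∧
      ∀ x ∈ l'.head?, ∀ y ∈ m'.head?, x ≠ y := by
  induction l generalizing m with
  | nil => exact ⟨[], [], m, rfl, rfl, by simp [commonPrefix], by simp⟩
  | cons x l ih =>
    rcases m with _ | ⟨y, m⟩
    · exact ⟨[], x :: l, [], rfl, rfl, by simp [commonPrefix], by simp⟩
    · by_cases h : x = y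
      · subst h
        obtain ⟨c, l', m', rfl, rfl, h1, h2⟩ := ih m
        exact ⟨x :: c, l', m', rfl, rfl, by simp [commonPrefix, h1], h2⟩
      · exact ⟨[], x :: l, y :: m, rfl, rfl, by simp [commonPrefix, h], by simpa using h⟩

end commonPrefix

variable {α : Type*} [DecidableEq α]

/-- The Gromov product of two elements of a free group. -/
def gromov (x y : FreeGroup α) : ℕ := commonPrefix x.toWord y.toWord

theorem gromov_comm (x y : FreeGroup α) : gromov x y = gromov y x := commonPrefix_comm _ _

theorem min_gromov_le (x y z : FreeGroup α) : min (gromov x y) (gromov y z) ≤ gromov x z :=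
  min_commonPrefix_le _ _ _

theorem IsReduced.invRev' {u : List (α × Bool)} (h : IsReduced u) : IsReduced (invRev u) := by
  rw [isReduced_iff_reduce_eq, reduce_invRev, h.reduce_eq]

theorem norm_inv_mul_add (x y : FreeGroup α) :
    (x⁻¹ * y).norm + 2 * gromov x y = x.norm + y.norm := by
  obtain ⟨c, u, v, hu, hv, hc, hne⟩ := exists_eq_append_commonPrefix x.toWord y.toWord
  have h1 : x⁻¹ * y = mk (invRev u ++ v) := by
    conv_lhs => rw [← mk_toWord (x := x), ← mk_toWord (x := y), hu, hv]
    rw [← mul_mk, ← mul_mk, ← mul_mk, ← inv_mk]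
    group
  have h2 : IsReduced (invRev u ++ v) := by
    unfold IsReduced
    have hu' : IsReduced u := (isReduced_toWord (x := x)).infix ⟨c, [], by simp [hu]⟩
    have hv' : IsReduced v := (isReduced_toWord (x := y)).infix ⟨c, [], by simp [hv]⟩
    rw [List.isChain_append]
    refine ⟨hu'.invRev', hv', ?_⟩
    intro a ha b hb hab
    rcases u with _ | ⟨z, u⟩
    · simp at ha
    · have := hne z (by simp) b hb
      simp only [invRev, map_cons, reverse_cons, getLast?_append, getLast?_singleton,
        Option.some_or, Option.mem_def, Option.some.injEq] at ha
      subst ha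
      obtain ⟨z1, z2⟩ := z
      obtain ⟨b1, b2⟩ := b
      simp only at hab
      subst hab
      cases z2 <;> cases b2 <;> simp_all
  unfold norm gromov
  rw [h1, toWord_mk_of_isReduced h2, ← hc, hu, hv]
  simp
  ring

theorem norm_mul_add (x y : FreeGroup α) :
    (x * y).norm + 2 * gromov x⁻¹ y = x.norm + y.norm := by
  have := norm_inv_mul_add x⁻¹ y
  rwa [inv_inv, norm_inv_eq] at this

/-- Write `x = c w c⁻¹` with `w` cyclically reduced: squaring adds one more copy of the nonempty
word `w`. -/
theorem norm_lt_norm_mul_self {x : FreeGroup α} (hx : x ≠ 1) : x.norm < (x * x).norm := by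
  have h1 := reduceCyclically.reduce_flatten_replicate_succ (isReduced_toWord (x := x)) 1
  have h2 := reduceCyclically.conj_conjugator_reduceCyclically x.toWord
  have h3 : (x * x).toWord = reduce (List.replicate (1 + 1) x.toWord).flatten := by
    rw [← toWord_pow, one_add_one_eq_two, pow_two]
  rw [h1] at h3
  unfold norm
  rw [h3]
  rcases hc : reduceCyclically x.toWord with _ | ⟨s, l⟩
  · rw [hc] at h2
    exfalso
    apply hx
    rw [← mk_toWord (x := x), ← h2, ← mul_mk, ← mul_mk, ← inv_mk, ← one_eq_mk]
    group
  · conv_lhs => rw [← h2, hc]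
    simp [List.replicate_succ]

theorem two_mul_gromov_lt {x : FreeGroup α} (hx : x ≠ 1) : 2 * gromov x⁻¹ x < x.norm := by
  have := norm_mul_add x x
  have := norm_lt_norm_mul_self hx
  omega

/-- If cancellation in products of images of letters is never complete, then a homomorphism does
not decrease lengths. -/
theorem length_add_gromov_le {ι : Type*} (ψ : FreeGroup ι →* FreeGroup α)
    (h : ∀ s t u : ι × Bool, (s.1 = t.1 → s.2 = t.2) → (t.1 = u.1 → t.2 = u.2) →
      gromov (ψ (mk [s]))⁻¹ (ψ (mk [t])) + gromov (ψ (mk [t]))⁻¹ (ψ (mk [u])) <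
        (ψ (mk [t])).norm) (l : List (ι × Bool)) (s : ι × Bool) (hl : IsReduced (s :: l)) :
    ∀ r : ι × Bool, (r.1 = s.1 → r.2 = s.2) →
      gromov (ψ (mk [r]))⁻¹ (ψ (mk (s :: l))) = gromov (ψ (mk [r]))⁻¹ (ψ (mk [s])) ∧
      (s :: l).length + gromov (ψ (mk [r]))⁻¹ (ψ (mk [s])) ≤ (ψ (mk (s :: l))).norm := by
  induction l generalizing s with
  | nil =>
    intro r hr
    have := h r s s hr (fun _ => rfl)
    simp only [length_cons, length_nil, true_and]
    omega
  | cons t l ih =>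
    intro r hr
    rw [isReduced_cons_cons] at hl
    obtain ⟨h1, h2⟩ := ih t hl.2 s hl.1
    have h3 := h r s t hr hl.1
    have h4 : (mk (s :: t :: l) : FreeGroup ι) = mk [s] * mk (t :: l) := by rw [mul_mk]; rfl
    rw [h4, _root_.map_mul]
    set x := ψ (mk [s])
    set y := ψ (mk (t :: l))
    set z := (ψ (mk [r]))⁻¹
    have h5 := norm_mul_add x y
    have h6 := norm_inv_mul_add x (x * y)
    rw [inv_mul_cancel_left] at h6
    -- `x` and `x * y` share `x.norm - gromov x⁻¹ y` letters, more than `z` shares with `x`. By the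
    -- ultrametric inequality, `z` shares equally much with both.
    have h7 := min_gromov_le z x (x * y)
    have h8 := min_gromov_le z (x * y) x
    rw [gromov_comm (x * y) x] at h8
    simp only [length_cons] at h2 ⊢
    omega

/-- The length-preserving automorphisms of a free group. -/
def isometries (α : Type*) [DecidableEq α] : Subgroup (MulAut (FreeGroup α)) where
  carrier := {s | ∀ x, (s x).norm = x.norm}
  mul_mem' := by
    intro s t hs ht x
    rw [MulAut.mul_apply, hs, ht]
  one_mem' := fun _ => rfl
  inv_mem' := by
    intro s hs x
    rw [← hs (s⁻¹ x), MulAut.apply_inv_self]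

theorem norm_le_of_letters (ψ : FreeGroup α →* FreeGroup α) (h : ∀ i, (ψ (of i)).norm ≤ 1)
    (x : FreeGroup α) : (ψ x).norm ≤ x.norm := by
  have key : ∀ l : List (α × Bool), (ψ (mk l)).norm ≤ l.length := by
    intro l
    induction l with
    | nil => rw [← one_eq_mk, _root_.map_one]; simp
    | cons s l ih =>
      have h4 : (mk (s :: l) : FreeGroup α) = mk [s] * mk l := by rw [mul_mk]; rfl
      rw [h4, _root_.map_mul]
      have h5 := norm_mul_le (ψ (mk [s])) (ψ (mk l))
      have h6 : (ψ (mk [s])).norm ≤ 1 := by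
        rcases s with ⟨i, _ | _⟩
        · have : (mk [(i, false)] : FreeGroup α) = (of i)⁻¹ := rfl
          rw [this, _root_.map_inv, norm_inv_eq]
          exact h i
        · exact h i
      simp only [length_cons]
      omega
  have := key x.toWord
  rwa [mk_toWord] at this

theorem norm_eq_one_iff {x : FreeGroup α} : x.norm = 1 ↔ ∃ s : α × Bool, x = mk [s] := by
  constructor
  · intro h
    obtain ⟨s, hs⟩ := List.length_eq_one_iff.1 h
    exact ⟨s, by rw [← hs, mk_toWord]⟩
  · rintro ⟨s, rfl⟩
    rw [norm, toWord_mk_of_isReduced (by simp)]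
    rfl

/-- There are finitely many elements of length one, so an injective self-map of this set is a
bijection; hence `ψ⁻¹` does not increase lengths either. -/
theorem mem_isometries_of_norm_le_one [Finite α] (ψ : MulAut (FreeGroup α))
    (h : ∀ i, (ψ (of i)).norm ≤ 1) : ψ ∈ isometries α := by
  set S : Set (FreeGroup α) := {x | x.norm = 1} with hS
  have hfin : S.Finite := by
    have : S = Set.range fun s : α × Bool => (mk [s] : FreeGroup α) := by
      ext x
      simp [hS, norm_eq_one_iff, eq_comm]
    rw [this]
    exact Set.finite_range _
  have hpos : ∀ φ : MulAut (FreeGroup α), ∀ x, x.norm = 1 → 1 ≤ (φ x).norm := by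
    intro φ x hx
    by_contra! h0
    have : φ x = 1 := norm_eq_zero.1 (by omega)
    rw [map_eq_one_iff φ φ.injective] at this
    rw [this] at hx
    simp at hx
  have hle := norm_le_of_letters ψ.toMonoidHom h
  have hmaps : Set.MapsTo ψ S S := by
    intro x hx
    have h1 := hle x
    have h2 := hpos ψ x hx
    simp only [hS, Set.mem_ofPred_eq] at hx ⊢
    change (ψ x).norm ≤ _ at h1
    omega
  have hsurj := (hfin.injOn_iff_bijOn_of_mapsTo hmaps).1 ψ.injective.injOn
  have hle' := norm_le_of_letters (ψ⁻¹ : MulAut (FreeGroup α)).toMonoidHom (by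
    intro i
    obtain ⟨y, hy, hyi⟩ := hsurj.2.2 (show of i ∈ S by simp [hS])
    change (ψ⁻¹ (of i)).norm ≤ 1
    rw [← hyi, MulAut.inv_apply_self]
    exact le_of_eq hy)
  intro x
  refine le_antisymm (hle x) ?_
  have := hle' (ψ x)
  change (ψ⁻¹ (ψ x)).norm ≤ _ at this
  rwa [MulAut.inv_apply_self] at this

end FreeGroup

/-! ### Nielsen reduction in rank two. -/

namespace FreeGroup

open List

/-- The letter to which a signed permutation of the generators sends a letter. -/
def signedLetter {α : Type*} (π : Equiv.Perm α) (e : α → Bool) (s : α × Bool) : α × Bool :=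
  (π s.1, s.2 == e s.1)

theorem lift_signedLetter {α : Type*} (π : Equiv.Perm α) (e : α → Bool) (l : List (α × Bool)) :
    lift (fun i => mk [signedLetter π e (i, true)]) (mk l) = mk (l.map (signedLetter π e)) := by
  induction l with
  | nil => rfl
  | cons s l ih =>
    have h1 : (mk (s :: l) : FreeGroup α) = mk [s] * mk l := by rw [mul_mk]; rfl
    rw [h1, _root_.map_mul, ih, List.map_cons]
    have h2 : (mk (signedLetter π e s :: l.map (signedLetter π e)) : FreeGroup α) =
        mk [signedLetter π e s] * mk (l.map (signedLetter π e)) := by rw [mul_mk]; rfl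
    rw [h2]
    congr 1
    obtain ⟨i, b⟩ := s
    cases b <;> cases h : e i <;> simp [signedLetter, h, invRev]

theorem lift_signedLetter_comp {α : Type*} (π ν : Equiv.Perm α) (e f : α → Bool)
    (h : ∀ i, ν (π i) = i) (h' : ∀ i, f (π i) = e i) :
    (lift fun i => mk [signedLetter ν f (i, true)]).comp
      (lift fun i => mk [signedLetter π e (i, true)]) = MonoidHom.id (FreeGroup α) := by
  apply FreeGroup.ext_hom
  intro i
  rw [MonoidHom.comp_apply, lift_apply_of, lift_signedLetter]
  simp [signedLetter, h, h', of]

/-- The automorphism permuting the generators up to signs. -/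
def signedPerm {α : Type*} (π : Equiv.Perm α) (e : α → Bool) : MulAut (FreeGroup α) :=
  MonoidHom.toMulEquiv (lift fun i => mk [signedLetter π e (i, true)])
    (lift fun i => mk [signedLetter π⁻¹ (fun j => e (π⁻¹ j)) (i, true)])
    (lift_signedLetter_comp _ _ _ _ (by simp) (by simp))
    (lift_signedLetter_comp _ _ _ _ (by simp) (by simp))

theorem signedPerm_mk {α : Type*} (π : Equiv.Perm α) (e : α → Bool) (l : List (α × Bool)) :
    signedPerm π e (mk l) = mk (l.map (signedLetter π e)) := lift_signedLetter π e l

theorem norm_mk_singleton {α : Type*} [DecidableEq α] (s : α × Bool) :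
    (mk [s] : FreeGroup α).norm = 1 := norm_eq_one_iff.2 ⟨s, rfl⟩

theorem signedPerm_mem_isometries {α : Type*} [DecidableEq α] [Finite α] (π : Equiv.Perm α)
    (e : α → Bool) : signedPerm π e ∈ isometries α := by
  apply mem_isometries_of_norm_le_one
  intro i
  rw [of, signedPerm_mk, List.map_singleton, norm_mk_singleton]

theorem eq_signedPerm_of_mem_isometries {s : MulAut (FreeGroup (Fin 2))}
    (hs : s ∈ isometries (Fin 2)) : ∃ π e, s = signedPerm π e := by
  have h : ∀ i, ∃ x : Fin 2 × Bool, s (of i) = mk [x] := by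
    intro i
    rw [← norm_eq_one_iff, hs, norm_of]
  choose f hf using h
  have hinj : Function.Injective fun i => (f i).1 := by
    intro i j hij
    have h2 : s (of i) = s (of j) ∨ s (of i) = s (of j)⁻¹ := by
      rw [_root_.map_inv, hf, hf]
      replace hij : (f i).1 = (f j).1 := hij
      obtain ⟨x, hx⟩ : ∃ x, x = f i := ⟨_, rfl⟩
      obtain ⟨y, hy⟩ : ∃ y, y = f j := ⟨_, rfl⟩
      rw [← hx, ← hy] at hij ⊢
      obtain ⟨x1, x2⟩ := x
      obtain ⟨y1, y2⟩ := y
      simp only at hij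
      subst hij
      cases x2 <;> cases y2 <;> simp [invRev]
    rcases h2 with h2 | h2
    · exact of_injective (s.injective h2)
    · have := s.injective h2
      have h3 := congrArg toWord this
      rw [toWord_inv, toWord_of, toWord_of] at h3
      simp [invRev] at h3
  refine ⟨Equiv.ofBijective _ (Finite.injective_iff_bijective.1 hinj), fun i => (f i).2, ?_⟩
  apply MulEquiv.toMonoidHom_injective
  apply FreeGroup.ext_hom
  intro i
  change s (of i) = signedPerm _ _ (mk [(i, true)])
  rw [signedPerm_mk, hf]
  simp [signedLetter]

theorem exists_signedPerm {s t : Fin 2 × Bool} (h : s.1 ≠ t.1) :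
    ∃ σ ∈ isometries (Fin 2), σ (of 0) = mk [s] ∧ σ (of 1) = mk [t] := by
  refine ⟨signedPerm (if s.1 = 0 then 1 else Equiv.swap 0 1) ![s.2, t.2],
    signedPerm_mem_isometries _ _, ?_⟩
  rw [of, of, signedPerm_mk, signedPerm_mk]
  obtain ⟨i, e⟩ := s
  obtain ⟨j, f⟩ := t
  fin_cases i <;> fin_cases j <;> simp [signedLetter] at h ⊢

/-- The automorphism `a ↦ a b`, `b ↦ b` of `F(a, b)`. -/
def transvection : MulAut (FreeGroup (Fin 2)) :=
  MonoidHom.toMulEquiv (lift ![of 0 * of 1, of 1]) (lift ![of 0 * (of 1)⁻¹, of 1])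
    (by apply FreeGroup.ext_hom; intro i; fin_cases i <;> simp)
    (by apply FreeGroup.ext_hom; intro i; fin_cases i <;> simp)

@[simp] theorem transvection_zero : transvection (of 0) = of 0 * of 1 := by
  change lift (![of 0 * of 1, of 1] : Fin 2 → FreeGroup (Fin 2)) (of 0) = _
  simp

@[simp] theorem transvection_one : transvection (of 1) = of 1 := by
  change lift (![of 0 * of 1, of 1] : Fin 2 → FreeGroup (Fin 2)) (of 1) = _
  simp

/-- The group generated by inner automorphisms, signed permutations and a transvection. -/
def elementaryGroup : Subgroup (MulAut (FreeGroup (Fin 2))) :=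
  Subgroup.closure (Set.range (MulAut.conj : FreeGroup (Fin 2) →* _) ∪ isometries (Fin 2) ∪
    {transvection})

theorem conj_mem_elementaryGroup (g : FreeGroup (Fin 2)) : MulAut.conj g ∈ elementaryGroup :=
  Subgroup.subset_closure (Or.inl (Or.inl ⟨g, rfl⟩))

theorem isometries_le_elementaryGroup : isometries (Fin 2) ≤ elementaryGroup :=
  fun _ h => Subgroup.subset_closure (Or.inl (Or.inr h))

theorem transvection_mem_elementaryGroup : transvection ∈ elementaryGroup :=
  Subgroup.subset_closure (Or.inr rfl)

/-- The total length of the images of the generators. -/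
def totalNorm (ψ : MulAut (FreeGroup (Fin 2))) : ℕ := (ψ (of 0)).norm + (ψ (of 1)).norm

theorem norm_mk_singleton_apply (ψ : MulAut (FreeGroup (Fin 2))) (s : Fin 2 × Bool) :
    (ψ (mk [s])).norm = (ψ (of s.1)).norm := by
  obtain ⟨i, _ | _⟩ := s
  · have : (mk [(i, false)] : FreeGroup (Fin 2)) = (of i)⁻¹ := rfl
    rw [this, _root_.map_inv, norm_inv_eq]
  · rfl

theorem norm_add_norm_eq_totalNorm (ψ : MulAut (FreeGroup (Fin 2))) {s t : Fin 2 × Bool}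
    (h : s.1 ≠ t.1) : (ψ (mk [s])).norm + (ψ (mk [t])).norm = totalNorm ψ := by
  rw [norm_mk_singleton_apply, norm_mk_singleton_apply, totalNorm]
  obtain ⟨i, e⟩ := s
  obtain ⟨j, f⟩ := t
  fin_cases i <;> fin_cases j <;> simp at h ⊢
  exact add_comm _ _

section minimal

variable {ψ : MulAut (FreeGroup (Fin 2))}

/-- Minimality is tested against a signed permutation, the transvection and an inner automorphism at
once. The freedom in `q` is needed when exactly half of a word cancels on each side. -/
theorem totalNorm_le_of_conj (hψ : ∀ g ∈ elementaryGroup, totalNorm ψ ≤ totalNorm (ψ * g))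
    {s t : Fin 2 × Bool} (h : s.1 ≠ t.1) (q : FreeGroup (Fin 2)) :
    (ψ (mk [s])).norm + (ψ (mk [t])).norm ≤
      (q * (ψ (mk [s]) * ψ (mk [t])) * q⁻¹).norm + (q * ψ (mk [t]) * q⁻¹).norm := by
  obtain ⟨σ, hσ, h0, h1⟩ := exists_signedPerm h
  rw [norm_add_norm_eq_totalNorm ψ h]
  have := hψ (MulAut.conj (ψ⁻¹ q) * σ * transvection)
    (mul_mem (mul_mem (conj_mem_elementaryGroup _) (isometries_le_elementaryGroup hσ))
      transvection_mem_elementaryGroup)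
  convert this using 1
  simp only [totalNorm, MulAut.mul_apply, transvection_zero, transvection_one, _root_.map_mul, h0,
    h1, MulAut.conj_apply, MulAut.apply_inv_self, _root_.map_inv]
  congr 2
  group

theorem norm_le_norm_mul (hψ : ∀ g ∈ elementaryGroup, totalNorm ψ ≤ totalNorm (ψ * g))
    {s t : Fin 2 × Bool} (h : s.1 ≠ t.1) :
    (ψ (mk [s])).norm ≤ (ψ (mk [s]) * ψ (mk [t])).norm := by
  have := totalNorm_le_of_conj hψ h 1
  simpa using this

theorem mk_singleton_not (s : Fin 2 × Bool) :
    (mk [(s.1, !s.2)] : FreeGroup (Fin 2)) = (mk [s])⁻¹ := by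
  simp [inv_mk, invRev]

theorem norm_le_norm_mul' (hψ : ∀ g ∈ elementaryGroup, totalNorm ψ ≤ totalNorm (ψ * g))
    {s t : Fin 2 × Bool} (h : s.1 ≠ t.1) :
    (ψ (mk [t])).norm ≤ (ψ (mk [s]) * ψ (mk [t])).norm := by
  have := norm_le_norm_mul hψ (s := (t.1, !t.2)) (t := (s.1, !s.2)) h.symm
  rw [mk_singleton_not, mk_singleton_not, _root_.map_inv, _root_.map_inv, ← mul_inv_rev,
    norm_inv_eq, norm_inv_eq] at this
  exact this

theorem apply_mk_singleton_ne_one (ψ : MulAut (FreeGroup (Fin 2))) (s : Fin 2 × Bool) :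
    ψ (mk [s]) ≠ 1 := by
  rw [Ne, map_eq_one_iff ψ ψ.injective]
  intro h
  have := norm_mk_singleton s
  rw [h, norm_one] at this
  omega

theorem two_mul_gromov_le (hψ : ∀ g ∈ elementaryGroup, totalNorm ψ ≤ totalNorm (ψ * g))
    {s t : Fin 2 × Bool} (h : s.1 = t.1 → s.2 = t.2) :
    2 * gromov (ψ (mk [s]))⁻¹ (ψ (mk [t])) ≤ (ψ (mk [s])).norm ∧
    2 * gromov (ψ (mk [s]))⁻¹ (ψ (mk [t])) ≤ (ψ (mk [t])).norm ∧
    (s.1 = t.1 → 2 * gromov (ψ (mk [s]))⁻¹ (ψ (mk [t])) < (ψ (mk [t])).norm) := by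
  by_cases hst : s.1 = t.1
  · obtain rfl : s = t := Prod.ext hst (h hst)
    have := two_mul_gromov_lt (apply_mk_singleton_ne_one ψ s)
    omega
  · have h1 := norm_le_norm_mul hψ hst
    have h2 := norm_le_norm_mul' hψ hst
    have h3 := norm_mul_add (ψ (mk [s])) (ψ (mk [t]))
    omega

/-- The two cancellations consume `y` exactly, so both halves of `y` appear inverted at the ends of
`x`. The bound `2 * n ≤ x.norm` keeps them disjoint there. -/
theorem exists_half_words {x y : FreeGroup (Fin 2)} {n : ℕ} (h1 : gromov x⁻¹ y = n)
    (h2 : gromov y⁻¹ x = n) (hy : y.norm = 2 * n) (hx : 2 * n ≤ x.norm) :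
    ∃ p q m, y = mk p * mk q ∧ x = (mk q)⁻¹ * mk m * (mk p)⁻¹ ∧ p.length = n ∧ q.length = n ∧
      m.length + 2 * n = x.norm := by
  obtain ⟨p, u, q, hu, hv, hc, -⟩ := exists_eq_append_commonPrefix x⁻¹.toWord y.toWord
  obtain ⟨r, v, w, hv', hw, hc', -⟩ := exists_eq_append_commonPrefix y⁻¹.toWord x.toWord
  have hp : p.length = n := hc.trans h1
  have hr : r.length = n := hc'.trans h2
  have hq : q.length = n := by
    have : y.norm = p.length + q.length := by rw [norm, hv, length_append]
    omega
  have hrq : r = invRev q := by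
    rw [toWord_inv, hv, invRev_append] at hv'
    exact (List.append_inj hv' (by simp [hq, hr])).1.symm
  have hxw : x.toWord = invRev u ++ invRev p := by
    rw [← invRev_append, ← hu, toWord_inv, invRev_invRev]
  have hul : u.length + n = x.norm := by
    rw [norm, hxw]; simp [hp]
  have : ∃ m, invRev u = r ++ m := by
    rw [hw] at hxw
    have : r <+: invRev u := List.prefix_of_prefix_length_le ⟨w, rfl⟩ ⟨invRev p, hxw.symm⟩ (by
      simp; omega)
    obtain ⟨m, hm⟩ := this
    exact ⟨m, hm.symm⟩
  obtain ⟨m, hm⟩ := this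
  refine ⟨p, q, m, ?_, ?_, hp, hq, ?_⟩
  · rw [mul_mk, ← hv, mk_toWord]
  · rw [inv_mk, inv_mk, mul_mk, mul_mk, ← hrq, ← hm, ← hxw, mk_toWord]
  · have := congrArg List.length hm
    simp at this
    omega

/-- Each cancellation takes at most half of the middle word, so failure means exactly half on both
sides. In rank two the outer letters then agree up to inversion, which leaves two cases. -/
theorem gromov_add_gromov_lt (hψ : ∀ g ∈ elementaryGroup, totalNorm ψ ≤ totalNorm (ψ * g))
    (s t u : Fin 2 × Bool) (hst : s.1 = t.1 → s.2 = t.2) (htu : t.1 = u.1 → t.2 = u.2) :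
    gromov (ψ (mk [s]))⁻¹ (ψ (mk [t])) + gromov (ψ (mk [t]))⁻¹ (ψ (mk [u])) <
      (ψ (mk [t])).norm := by
  obtain ⟨h1, h2, h3⟩ := two_mul_gromov_le hψ hst
  obtain ⟨h4, h5, h6⟩ := two_mul_gromov_le hψ htu
  by_contra! hle
  have hst' : s.1 ≠ t.1 := fun h => by have := h3 h; omega
  have htu' : t.1 ≠ u.1 := fun h => by
    obtain rfl : t = u := Prod.ext h (htu h)
    have := h6 rfl
    omega
  have hsu : u.1 = s.1 := by
    revert hst' htu'
    generalize s.1 = i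
    generalize t.1 = j
    generalize u.1 = k
    revert i j k
    decide
  have hne := apply_mk_singleton_ne_one ψ t
  have hpos : 0 < (ψ (mk [t])).norm := Nat.pos_of_ne_zero (by rwa [Ne, norm_eq_zero])
  by_cases hsu' : u.2 = s.2
  · obtain rfl : u = s := Prod.ext hsu hsu'
    set n := gromov (ψ (mk [u]))⁻¹ (ψ (mk [t])) with hn
    obtain ⟨p, q, m, hy, hx, hp, hq, hm⟩ := exists_half_words (x := ψ (mk [u])) (y := ψ (mk [t]))
      (n := n) rfl (by omega) (by omega) (by omega)
    -- Conjugating by `q` shortens the product to `m` and turns `p q` into `q p`; the total length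
    -- drops by at least `2 * n > 0`.
    have := totalNorm_le_of_conj hψ hst' (mk q)
    have e1 : mk q * (ψ (mk [u]) * ψ (mk [t])) * (mk q)⁻¹ = mk m := by
      rw [hx, hy]; group
    have e2 : mk q * ψ (mk [t]) * (mk q)⁻¹ = mk (q ++ p) := by
      rw [hy, ← mul_mk]; group
    rw [e1, e2] at this
    have b1 := norm_mk_le (L₁ := m)
    have b2 := norm_mk_le (L₁ := q ++ p)
    rw [length_append] at b2
    omega
  · have hinv : ψ (mk [u]) = (ψ (mk [s]))⁻¹ := by
      rw [← _root_.map_inv, ← mk_singleton_not]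
      congr 2
      rw [← hsu]
      have : u.2 = !s.2 := by revert hsu'; cases u.2 <;> cases s.2 <;> simp
      rw [← this]
    rw [hinv] at h4 h5 hle
    -- The images of `t` and `t⁻¹` would share a prefix of half their length, which
    -- `two_mul_gromov_lt` forbids.
    have h7 := min_gromov_le (ψ (mk [t])) (ψ (mk [s]))⁻¹ (ψ (mk [t]))⁻¹
    rw [gromov_comm (ψ (mk [t])), gromov_comm _ (ψ (mk [t]))⁻¹] at h7
    have h8 := two_mul_gromov_lt hne
    rw [gromov_comm] at h8
    omega

end minimal

/-- At an element of minimal total length in the coset of `δ`, no cancellation is complete, so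
lengths do not decrease. Preimages of generators then have length at most one, and the minimal
element is a signed permutation. -/
theorem mem_elementaryGroup (δ : MulAut (FreeGroup (Fin 2))) : δ ∈ elementaryGroup := by
  obtain ⟨⟨g, hg⟩, hmin⟩ : ∃ g : elementaryGroup, ∀ h : elementaryGroup,
      totalNorm (δ * g) ≤ totalNorm (δ * h) :=
    ⟨Function.argmin (fun g : elementaryGroup => totalNorm (δ * g)),
      fun h => Function.argmin_le (fun g : elementaryGroup => totalNorm (δ * g)) h⟩
  have hψ : ∀ h ∈ elementaryGroup, totalNorm (δ * g) ≤ totalNorm (δ * g * h) := fun h hh => by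
    rw [mul_assoc]
    exact hmin ⟨g * h, mul_mem hg hh⟩
  have hiso : (δ * g)⁻¹ ∈ isometries (Fin 2) := by
    apply mem_isometries_of_norm_le_one
    intro i
    set x := (δ * g)⁻¹ (of i) with hx
    rcases hw : x.toWord with _ | ⟨s, l⟩
    · rw [norm, hw]; simp
    · have h1 := (length_add_gromov_le (δ * g).toMonoidHom (gromov_add_gromov_lt hψ) l s (by
        rw [← hw]; exact isReduced_toWord) s (fun _ => rfl)).2
      have h2 : mk (s :: l) = x := by rw [← hw, mk_toWord]
      rw [h2] at h1
      have h3 : (δ * g).toMonoidHom x = of i := MulAut.apply_inv_self _ _ _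
      rw [h3, norm_of] at h1
      rw [norm, hw]
      omega
  have h1 := mul_mem (inv_mem (isometries_le_elementaryGroup hiso)) (inv_mem hg)
  simpa using h1

end FreeGroup

/-! ### Decomposition into positive transvections. -/

namespace FreeGroup

open List

/-- The automorphism exchanging the two generators of `F(a, b)`. -/
def exchange : MulAut (FreeGroup (Fin 2)) := signedPerm (Equiv.swap 0 1) fun _ => true

theorem exchange_zero : exchange (of 0) = of 1 := by
  rw [exchange, of, signedPerm_mk]; simp [signedLetter, of]

theorem exchange_one : exchange (of 1) = of 0 := by
  rw [exchange, of, signedPerm_mk]; simp [signedLetter, of]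

theorem exchange_mem_isometries : exchange ∈ isometries (Fin 2) := signedPerm_mem_isometries _ _

theorem mulAut_ext {φ ψ : MulAut (FreeGroup (Fin 2))} (h0 : φ (of 0) = ψ (of 0))
    (h1 : φ (of 1) = ψ (of 1)) : φ = ψ := by
  apply MulEquiv.toMonoidHom_injective
  apply FreeGroup.ext_hom
  intro i
  fin_cases i
  exacts [h0, h1]

theorem exchange_inv : exchange⁻¹ = exchange := by
  rw [inv_eq_iff_mul_eq_one]
  apply mulAut_ext <;> simp [exchange_zero, exchange_one]

/-- The automorphism `a ↦ a`, `b ↦ b a` of `F(a, b)`. -/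
def transvection' : MulAut (FreeGroup (Fin 2)) := exchange * transvection * exchange

@[simp] theorem transvection'_zero : transvection' (of 0) = of 0 := by
  simp [transvection', exchange_zero, exchange_one]

@[simp] theorem transvection'_one : transvection' (of 1) = of 1 * of 0 := by
  simp [transvection', exchange_zero, exchange_one]

/-- The monoid generated by the two positive transvections. -/
def positiveMonoid : Submonoid (MulAut (FreeGroup (Fin 2))) :=
  Submonoid.closure {transvection, transvection'}

theorem transvection_mem_positiveMonoid : transvection ∈ positiveMonoid :=
  Submonoid.subset_closure (by simp)

theorem transvection'_mem_positiveMonoid : transvection' ∈ positiveMonoid :=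
  Submonoid.subset_closure (by simp)

/-- An automorphism is positively decomposed if up to inner automorphisms and signed permutations
on both sides it is a product of positive transvections. -/
def IsPositivelyDecomposed (δ : MulAut (FreeGroup (Fin 2))) : Prop :=
  ∃ h, ∃ P ∈ isometries (Fin 2), ∃ M ∈ positiveMonoid, ∃ Q ∈ isometries (Fin 2),
    δ = MulAut.conj h * P * M * Q

theorem mul_conj_eq {G : Type*} [Group G] (δ : MulAut G) (g : G) :
    δ * MulAut.conj g = MulAut.conj (δ g) * δ := by
  ext x
  simp

namespace IsPositivelyDecomposed

variable {δ : MulAut (FreeGroup (Fin 2))}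

theorem of_mem {M : MulAut (FreeGroup (Fin 2))} (h : M ∈ positiveMonoid) :
    IsPositivelyDecomposed M := ⟨1, 1, one_mem _, M, h, 1, one_mem _, by simp⟩

theorem mul_isometry (h : IsPositivelyDecomposed δ) {s : MulAut (FreeGroup (Fin 2))}
    (hs : s ∈ isometries (Fin 2)) : IsPositivelyDecomposed (δ * s) := by
  obtain ⟨h, P, hP, M, hM, Q, hQ, rfl⟩ := h
  exact ⟨h, P, hP, M, hM, Q * s, mul_mem hQ hs, by simp only [mul_assoc]⟩

theorem conj_mul (h : IsPositivelyDecomposed δ) (g : FreeGroup (Fin 2)) :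
    IsPositivelyDecomposed (MulAut.conj g * δ) := by
  obtain ⟨h, P, hP, M, hM, Q, hQ, rfl⟩ := h
  exact ⟨g * h, P, hP, M, hM, Q, hQ, by simp only [mul_assoc, _root_.map_mul]⟩

theorem mul_conj (h : IsPositivelyDecomposed δ) (g : FreeGroup (Fin 2)) :
    IsPositivelyDecomposed (δ * MulAut.conj g) := by
  rw [mul_conj_eq]
  exact h.conj_mul _

theorem isometry_mul (h : IsPositivelyDecomposed δ) {s : MulAut (FreeGroup (Fin 2))}
    (hs : s ∈ isometries (Fin 2)) : IsPositivelyDecomposed (s * δ) := by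
  obtain ⟨h, P, hP, M, hM, Q, hQ, rfl⟩ := h
  refine ⟨s h, s * P, mul_mem hs hP, M, hM, Q, hQ, ?_⟩
  rw [← mul_assoc (MulAut.conj (s h)), ← mul_conj_eq]
  simp only [mul_assoc]

end IsPositivelyDecomposed

theorem transvection_symm_zero : MulEquiv.symm transvection (of 0) = of 0 * (of 1)⁻¹ := by
  apply transvection.injective
  rw [MulEquiv.apply_symm_apply]
  simp

theorem transvection_symm_one : MulEquiv.symm transvection (of 1) = of 1 := by
  apply transvection.injective
  rw [MulEquiv.apply_symm_apply]
  simp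

theorem transvection'_symm_zero : MulEquiv.symm transvection' (of 0) = of 0 := by
  apply transvection'.injective
  rw [MulEquiv.apply_symm_apply]
  simp

theorem transvection'_symm_one : MulEquiv.symm transvection' (of 1) = of 1 * (of 0)⁻¹ := by
  apply transvection'.injective
  rw [MulEquiv.apply_symm_apply]
  simp

theorem isometry_mul_transvection {Q : MulAut (FreeGroup (Fin 2))}
    (hQ : Q ∈ isometries (Fin 2)) : ∃ h, ∃ t : MulAut (FreeGroup (Fin 2)),
      (t = transvection ∨ t = transvection' ∨ t = transvection⁻¹ ∨ t = transvection'⁻¹) ∧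
      Q * transvection = MulAut.conj h * t * Q := by
  obtain ⟨π, e, rfl⟩ := eq_signedPerm_of_mem_isometries hQ
  have h0 : signedPerm π e (of 0) = mk [(π 0, e 0)] := by
    rw [of, signedPerm_mk]; simp [signedLetter]
  have h1 : signedPerm π e (of 1) = mk [(π 1, e 1)] := by
    rw [of, signedPerm_mk]; simp [signedLetter]
  have hof : ∀ i : Fin 2, mk [(i, true)] = of i := fun _ => rfl
  have hof' : ∀ i : Fin 2, mk [(i, false)] = (of i)⁻¹ := fun _ => rfl
  have hne : π 0 ≠ π 1 := fun h => by simpa using π.injective h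
  have hπ : (π 0 = 0 ∧ π 1 = 1) ∨ (π 0 = 1 ∧ π 1 = 0) := by omega
  rcases hπ with ⟨hx, hy⟩ | ⟨hx, hy⟩ <;> rw [hx] at h0 <;> rw [hy] at h1 <;>
    rcases e0 : e 0 with _ | _ <;> rcases e1 : e 1 with _ | _ <;> rw [e0] at h0 <;>
    rw [e1] at h1 <;> simp only [hof, hof'] at h0 h1
  · refine ⟨of 1, transvection, by simp, mulAut_ext ?_ ?_⟩ <;> simp [h0, h1]
  · refine ⟨(of 1)⁻¹, transvection⁻¹, by simp, mulAut_ext ?_ ?_⟩ <;>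
      simp [h0, h1, transvection_symm_zero, transvection_symm_one]
  · refine ⟨1, transvection⁻¹, by simp, mulAut_ext ?_ ?_⟩ <;>
      simp [h0, h1, transvection_symm_zero, transvection_symm_one]
  · refine ⟨1, transvection, by simp, mulAut_ext ?_ ?_⟩ <;> simp [h0, h1]
  · refine ⟨of 0, transvection', by simp, mulAut_ext ?_ ?_⟩ <;> simp [h0, h1]
  · refine ⟨(of 0)⁻¹, transvection'⁻¹, by simp, mulAut_ext ?_ ?_⟩ <;>
      simp [h0, h1, transvection'_symm_zero, transvection'_symm_one]
  · refine ⟨1, transvection'⁻¹, by simp, mulAut_ext ?_ ?_⟩ <;>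
      simp [h0, h1, transvection'_symm_zero, transvection'_symm_one]
  · refine ⟨1, transvection', by simp, mulAut_ext ?_ ?_⟩ <;> simp [h0, h1]

theorem exists_signFlip : ∃ s ∈ isometries (Fin 2),
    transvection⁻¹ = s * transvection * s⁻¹ := by
  obtain ⟨s, hs, h0, h1⟩ := exists_signedPerm (s := (0, true)) (t := (1, false)) (by simp)
  refine ⟨s, hs, ?_⟩
  rw [eq_mul_inv_iff_mul_eq]
  have hof : mk [((0 : Fin 2), true)] = of 0 := rfl
  have hof' : mk [((1 : Fin 2), false)] = (of 1)⁻¹ := rfl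
  rw [hof] at h0
  rw [hof'] at h1
  apply mulAut_ext <;> simp [h0, h1, transvection_symm_zero, transvection_symm_one]

/-- The relation that absorbs an inverse transvection into a positive one, at the cost of an inner
automorphism and the signed permutation `a ↦ b⁻¹`, `b ↦ a`. -/
theorem transvection'_mul_transvection_inv : ∃ S ∈ isometries (Fin 2),
    transvection' * transvection⁻¹ = MulAut.conj (of 1) * transvection * S := by
  obtain ⟨s, hs, h0, h1⟩ := exists_signedPerm (s := (1, false)) (t := (0, true)) (by simp)
  refine ⟨s, hs, ?_⟩
  have hof : mk [((0 : Fin 2), true)] = of 0 := rfl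
  have hof' : mk [((1 : Fin 2), false)] = (of 1)⁻¹ := rfl
  rw [hof'] at h0
  rw [hof] at h1
  apply mulAut_ext <;> simp [h0, h1, transvection_symm_zero, transvection_symm_one]
  group

theorem exchange_mul_transvection' : exchange * transvection' = transvection * exchange := by
  rw [← mul_inv_eq_iff_eq_mul]
  nth_rewrite 1 [← exchange_inv]
  rw [transvection', exchange_inv]
  have : exchange * exchange = 1 := by
    nth_rewrite 1 [← exchange_inv]; simp
  calc _ = (exchange * exchange) * transvection * (exchange * exchange) := by
        simp only [mul_assoc]
    _ = _ := by rw [this]; simp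

/-- Only the last factor of `M` matters: `transvection` cancels, `transvection'` absorbs the
inverse, and for `M = 1` a sign flip makes it positive. -/
theorem isPositivelyDecomposed_mul_transvection_inv {M : MulAut (FreeGroup (Fin 2))}
    (hM : M ∈ positiveMonoid) : IsPositivelyDecomposed (M * transvection⁻¹) := by
  induction hM using Submonoid.closure_induction_right with
  | one =>
    obtain ⟨s, hs, h⟩ := exists_signFlip
    rw [one_mul, h]
    exact ((IsPositivelyDecomposed.of_mem transvection_mem_positiveMonoid).isometry_mul
      hs).mul_isometry (inv_mem hs)
  | mul_right M hM t ht ih =>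
    rcases ht with rfl | rfl
    · rw [mul_inv_cancel_right]
      exact .of_mem hM
    · obtain ⟨S, hS, h⟩ := transvection'_mul_transvection_inv
      rw [mul_assoc, h, ← mul_assoc, ← mul_assoc, mul_conj_eq, mul_assoc (MulAut.conj _)]
      exact ((IsPositivelyDecomposed.of_mem (mul_mem hM
        transvection_mem_positiveMonoid)).conj_mul _).mul_isometry hS

theorem exchange_mul_mul_mem {M : MulAut (FreeGroup (Fin 2))} (hM : M ∈ positiveMonoid) :
    exchange * M * exchange ∈ positiveMonoid := by
  have he : exchange * exchange = 1 := by
    nth_rewrite 1 [← exchange_inv]; simp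
  induction hM using Submonoid.closure_induction_right with
  | one => rw [mul_one, he]; exact one_mem _
  | mul_right M hM t ht ih =>
    have h1 : exchange * (M * t) * exchange = (exchange * M * exchange) *
        (exchange * t * exchange) := by
      calc _ = exchange * M * 1 * t * exchange := by simp only [mul_assoc, one_mul]
        _ = _ := by rw [← he]; simp only [mul_assoc]
    rw [h1]
    refine mul_mem ih ?_
    rcases ht with rfl | rfl
    · exact transvection'_mem_positiveMonoid
    · rw [exchange_mul_transvection', mul_assoc, he, mul_one]
      exact transvection_mem_positiveMonoid

theorem isPositivelyDecomposed_mul_transvection'_inv {M : MulAut (FreeGroup (Fin 2))}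
    (hM : M ∈ positiveMonoid) : IsPositivelyDecomposed (M * transvection'⁻¹) := by
  have he : exchange * exchange = 1 := by
    nth_rewrite 1 [← exchange_inv]; simp
  have h1 := isPositivelyDecomposed_mul_transvection_inv (exchange_mul_mul_mem hM)
  have h2 := (h1.isometry_mul exchange_mem_isometries).mul_isometry exchange_mem_isometries
  convert h2 using 1
  rw [transvection', mul_inv_rev, mul_inv_rev, exchange_inv]
  calc _ = 1 * M * exchange * transvection⁻¹ * exchange := by simp only [mul_assoc, one_mul]
    _ = _ := by rw [← he]; simp only [mul_assoc]

theorem IsPositivelyDecomposed.mul_transvection {δ : MulAut (FreeGroup (Fin 2))}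
    (h : IsPositivelyDecomposed δ) : IsPositivelyDecomposed (δ * transvection) := by
  obtain ⟨h, P, hP, M, hM, Q, hQ, rfl⟩ := h
  obtain ⟨g, t, ht, hgt⟩ := isometry_mul_transvection hQ
  have hMt : IsPositivelyDecomposed (M * t) := by
    rcases ht with rfl | rfl | rfl | rfl
    · exact .of_mem (mul_mem hM transvection_mem_positiveMonoid)
    · exact .of_mem (mul_mem hM transvection'_mem_positiveMonoid)
    · exact isPositivelyDecomposed_mul_transvection_inv hM
    · exact isPositivelyDecomposed_mul_transvection'_inv hM
  have h1 : MulAut.conj h * P * M * Q * transvection =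
      MulAut.conj h * (P * (MulAut.conj (M g) * (M * t) * Q)) := by
    rw [mul_assoc, hgt, ← mul_assoc (MulAut.conj (M g)), ← mul_conj_eq]
    simp only [mul_assoc]
  rw [h1]
  exact (((hMt.conj_mul _).mul_isometry hQ).isometry_mul hP).conj_mul _

theorem isPositivelyDecomposed (δ : MulAut (FreeGroup (Fin 2))) : IsPositivelyDecomposed δ := by
  have hδ := mem_elementaryGroup δ
  unfold elementaryGroup at hδ
  induction hδ using Subgroup.closure_induction_right with
  | one => exact .of_mem (one_mem _)
  | mul_right δ _ s hs ih =>
    rcases hs with (⟨g, rfl⟩ | hs) | rfl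
    · exact ih.mul_conj g
    · exact ih.mul_isometry hs
    · exact ih.mul_transvection
  | mul_inv_cancel δ _ s hs ih =>
    rcases hs with (⟨g, rfl⟩ | hs) | rfl
    · rw [← _root_.map_inv]
      exact ih.mul_conj _
    · exact ih.mul_isometry (inv_mem hs)
    · obtain ⟨s, hs, h⟩ := exists_signFlip
      rw [h, ← mul_assoc, ← mul_assoc]
      exact ((ih.mul_isometry hs).mul_transvection).mul_isometry (inv_mem hs)

end FreeGroup

/-! ### Growth of cyclic words under positive transvections. -/

namespace FreeGroup

open List

section cyclicCount

variable {β : Type*}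

/-- The number of pairs of consecutive letters satisfying `p`, where `z` follows the last one. -/
def pairCount (p : β → β → Bool) : List β → β → ℕ
  | [], _ => 0
  | x :: l, z => (p x (l.headD z)).toNat + pairCount p l z

theorem pairCount_append (p : β → β → Bool) (l m : List β) (z : β) :
    pairCount p (l ++ m) z = pairCount p l (m.headD z) + pairCount p m z := by
  induction l with
  | nil => simp [pairCount]
  | cons x l ih =>
    rw [cons_append, pairCount, ih, pairCount]
    cases l <;> simp [add_assoc]

theorem pairCount_rotate (p : β → β → Bool) (x : β) (l m : List β) (z w : β) :
    pairCount p (x :: l ++ m) ((x :: l ++ m).headD z) =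
      pairCount p (m ++ x :: l) ((m ++ x :: l).headD w) := by
  rw [pairCount_append, pairCount_append]
  cases m <;> simp [pairCount, add_comm, add_left_comm]

theorem pairCount_mono {p q : β → β → Bool} (h : ∀ x y, p x y → q x y) (l : List β) (z : β) :
    pairCount p l z ≤ pairCount q l z := by
  induction l with
  | nil => rfl
  | cons x l ih =>
    rw [pairCount, pairCount]
    refine Nat.add_le_add ?_ ih
    have := h x (l.headD z)
    revert this
    cases p x (l.headD z) <;> cases q x (l.headD z) <;> simp

theorem pairCount_map {γ : Type*} (p : β → β → Bool) (q : γ → γ → Bool) (f : γ → β)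
    (h : ∀ x y, p (f x) (f y) = q x y) (l : List γ) (z : γ) :
    pairCount p (l.map f) (f z) = pairCount q l z := by
  induction l with
  | nil => rfl
  | cons x l ih =>
    rw [List.map_cons, pairCount, pairCount, ih]
    congr 2
    rw [← h]
    cases l <;> rfl

end cyclicCount

/-- Letters of different types and opposite signs. -/
def opposite (x y : Fin 2 × Bool) : Bool := x.1 ≠ y.1 ∧ x.2 ≠ y.2

/-- Letters of different types. -/
def changing (x y : Fin 2 × Bool) : Bool := x.1 ≠ y.1

/-- The conjugacy class of `g` is represented by a cyclically reduced word with `m` letters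
`a^{±1}` and `n` letters `b^{±1}`, and less than `m` and `n` cyclically consecutive pairs of
letters satisfying `p`. -/
def HasProfile (p : Fin 2 × Bool → Fin 2 × Bool → Bool) (g : FreeGroup (Fin 2)) (m n : ℕ) :
    Prop :=
  ∃ l, IsCyclicallyReduced l ∧ (∃ h, g = h * mk l * h⁻¹) ∧ l.countP (fun x => x.1 = 0) = m ∧
    l.countP (fun x => x.1 = 1) = n ∧ (∀ z, pairCount p l (l.headD z) < m) ∧
    ∀ z, pairCount p l (l.headD z) < n

theorem HasProfile.mono {p q : Fin 2 × Bool → Fin 2 × Bool → Bool} (hpq : ∀ x y, q x y → p x y)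
    {g : FreeGroup (Fin 2)} {m n : ℕ} (H : HasProfile p g m n) : HasProfile q g m n := by
  obtain ⟨l, h1, h2, h3, h4, h5, h6⟩ := H
  exact ⟨l, h1, h2, h3, h4, fun z => (pairCount_mono hpq _ _).trans_lt (h5 z),
    fun z => (pairCount_mono hpq _ _).trans_lt (h6 z)⟩

theorem IsCyclicallyReduced.map_signedLetter {α : Type*} {l : List (α × Bool)}
    (h : IsCyclicallyReduced l) (π : Equiv.Perm α) (e : α → Bool) :
    IsCyclicallyReduced (l.map (signedLetter π e)) := by
  have key : ∀ x y : α × Bool, (x.1 = y.1 → x.2 = y.2) →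
      (signedLetter π e x).1 = (signedLetter π e y).1 →
      (signedLetter π e x).2 = (signedLetter π e y).2 := by
    intro x y hxy h1
    have h2 := π.injective h1
    simp [signedLetter, h2, hxy h2]
  refine ⟨(List.isChain_map _).2 (h.1.imp fun x y => key x y), ?_⟩
  intro x hx y hy
  simp only [getLast?_map, Option.mem_def, Option.map_eq_some_iff, head?_map] at hx hy
  obtain ⟨x, hx, rfl⟩ := hx
  obtain ⟨y, hy, rfl⟩ := hy
  exact key x y (h.2 x hx y hy)

theorem HasProfile.signedPerm_apply {p : Fin 2 × Bool → Fin 2 × Bool → Bool} {g : FreeGroup (Fin 2)}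
    {m n : ℕ} (H : HasProfile p g m n) (π : Equiv.Perm (Fin 2)) (e : Fin 2 → Bool)
    (hp : ∀ x y, p (signedLetter π e x) (signedLetter π e y) = p x y) :
    (π 0 = 0 → HasProfile p (signedPerm π e g) m n) ∧
      (π 0 = 1 → HasProfile p (signedPerm π e g) n m) := by
  obtain ⟨l, h1, ⟨h, rfl⟩, h3, h4, h5, h6⟩ := H
  have hc : ∃ k, signedPerm π e (h * mk l * h⁻¹) = k * mk (l.map (signedLetter π e)) * k⁻¹ :=
    ⟨signedPerm π e h, by simp only [_root_.map_mul, _root_.map_inv, signedPerm_mk]⟩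
  have hl : l ≠ [] := by
    rintro rfl
    have := h5 (0, true)
    simp [← h3] at this
  obtain ⟨x, l, rfl⟩ := List.exists_cons_of_ne_nil hl
  have hpc : ∀ z, pairCount p ((x :: l).map (signedLetter π e))
      (((x :: l).map (signedLetter π e)).headD z) = pairCount p (x :: l) ((x :: l).headD z) :=
    fun z => pairCount_map p p (signedLetter π e) hp (x :: l) x
  have hne : π 0 ≠ π 1 := fun h => by simpa using π.injective h
  constructor <;> intro hπ
  · have hπ1 : π 1 = 1 := by omega
    have hs : ∀ y : Fin 2 × Bool, (signedLetter π e y).1 = y.1 := by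
      rintro ⟨i, f⟩
      fin_cases i <;> simp [signedLetter, hπ, hπ1]
    refine ⟨_, h1.map_signedLetter π e, hc, ?_, ?_, fun z => ?_, fun z => ?_⟩
    · rw [List.countP_map, ← h3]; congr 1; funext y; simp [hs]
    · rw [List.countP_map, ← h4]; congr 1; funext y; simp [hs]
    · rw [hpc]; exact h5 z
    · rw [hpc]; exact h6 z
  · have hπ1 : π 1 = 0 := by omega
    have hs : ∀ y : Fin 2 × Bool, ((signedLetter π e y).1 = 1 ↔ y.1 = 0) ∧
        ((signedLetter π e y).1 = 0 ↔ y.1 = 1) := by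
      rintro ⟨i, f⟩
      fin_cases i <;> simp [signedLetter, hπ, hπ1]
    refine ⟨_, h1.map_signedLetter π e, hc, ?_, ?_, fun z => ?_, fun z => ?_⟩
    · rw [List.countP_map, ← h4]; congr 1; funext y; simp [hs]
    · rw [List.countP_map, ← h3]; congr 1; funext y; simp [hs]
    · rw [hpc]; exact h6 z
    · rw [hpc]; exact h5 z

/-! ### The effect of a transvection on gap words -/

theorem exists_eq_gapLetters_append {l : List (Fin 2 × Bool)} (h : IsReduced l) :
    ∃ k m, l = gapLetters k ++ gapWord m := by
  induction l with
  | nil => exact ⟨0, [], rfl⟩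
  | cons x l ih =>
    obtain ⟨k, m, rfl⟩ := ih (h.infix ⟨[x], [], by simp⟩)
    obtain ⟨i, e⟩ := x
    fin_cases i
    · exact ⟨0, (e, k) :: m, rfl⟩
    · rcases Nat.eq_zero_or_pos k.natAbs with hk | hk
      · obtain rfl : k = 0 := by omega
        cases e
        · exact ⟨-1, m, rfl⟩
        · exact ⟨1, m, rfl⟩
      · obtain ⟨n, hn⟩ : ∃ n, k.natAbs = n + 1 := ⟨k.natAbs - 1, by omega⟩
        have he : e = decide (0 ≤ k) := by
          rw [gapLetters, hn, List.replicate_succ, cons_append, isReduced_cons_cons] at h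
          exact h.1 rfl
        refine ⟨k + sgn e, m, ?_⟩
        rw [← cons_append]
        congr 1
        unfold gapLetters
        have h1 : (k + sgn e).natAbs = k.natAbs + 1 := by
          by_cases h0 : 0 ≤ k <;> simp [he, h0] <;> omega
        have h2 : decide (0 ≤ k + sgn e) = decide (0 ≤ k) := by
          by_cases h0 : 0 ≤ k <;> simp [he, h0] <;> omega
        rw [h1, h2, List.replicate_succ, he]
        rfl

theorem isChain_of_isReduced_gapWord {l : List (Bool × ℤ)} {x : Bool × ℤ}
    (h : IsReduced (gapWord l ++ [(0, x.1)])) : (l ++ [x]).IsChain GapFit := by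
  induction l with
  | nil => simp
  | cons y l ih =>
    rw [gapWord_cons] at h
    have h1 := ih (h.infix ⟨(0, y.1) :: gapLetters y.2, [], by simp⟩)
    obtain ⟨z, m, hz, hr⟩ : ∃ z m, l ++ [x] = z :: m ∧
        ∃ r, gapWord l ++ [(0, x.1)] = (0, z.1) :: r := by
      rcases l with _ | ⟨z, l⟩
      · exact ⟨x, [], rfl, [], rfl⟩
      · exact ⟨z, l ++ [x], rfl, _, rfl⟩
    obtain ⟨r, hr⟩ := hr
    rw [cons_append, hz, isChain_cons_cons, ← hz]
    refine ⟨?_, h1⟩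
    intro hne h0
    rw [cons_append, append_assoc, hr, h0] at h
    exact hne ((isReduced_cons_cons.1 h).1 rfl)

/-- The change of a gap between letters of signs `e`, `e'` under the transvection. -/
def gapShift (e e' : Bool) : ℤ := if e = e' then sgn e else 0

/-- The sign of the first entry, or `z` if there is none. -/
def nextSign (l : List (Bool × ℤ)) (z : Bool) : Bool := (l.map Prod.fst).headD z

/-- The image of a gap word under the transvection, when it is followed by `a^z`. -/
def shiftGaps : List (Bool × ℤ) → Bool → List (Bool × ℤ)
  | [], _ => []
  | x :: l, z => (x.1, x.2 + gapShift x.1 (nextSign l z)) :: shiftGaps l z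

/-- Since `a⁻¹ ↦ b⁻¹ a⁻¹`, a negative letter sends its `b⁻¹` into the preceding gap. The factors at
both ends account for the `b⁻¹` coming from the next letter and the one leaving the first. -/
theorem transvection_mk_gapWord (l : List (Bool × ℤ)) (z : Bool) :
    transvection (mk (gapWord l)) * (if z then 1 else (of 1)⁻¹) =
      (if nextSign l z then 1 else (of 1)⁻¹) * mk (gapWord (shiftGaps l z)) := by
  induction l with
  | nil =>
    simp only [gapWord_nil, shiftGaps, nextSign, List.map_nil, List.headD_nil, ← one_eq_mk,
      _root_.map_one, one_mul, mul_one]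
  | cons x l ih =>
    obtain ⟨e, k⟩ := x
    rw [mk_gapWord_cons, _root_.map_mul, mul_assoc, ih, shiftGaps, mk_gapWord_cons]
    rw [show nextSign ((e, k) :: l) z = e from rfl]
    generalize nextSign l z = e'
    generalize mk (gapWord (shiftGaps l z)) = w
    cases e <;> cases e' <;> simp [gapShift] <;> group

theorem isChain_shiftGaps {l : List (Bool × ℤ)} {x y : Bool × ℤ}
    (h : (l ++ [x]).IsChain GapFit) (hxy : x.1 = y.1) :
    (shiftGaps l x.1 ++ [y]).IsChain GapFit := by
  induction l with
  | nil => simp [shiftGaps]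
  | cons w l ih =>
    have h1 := ih h.tail
    obtain ⟨u, m, hu, hw, v, n, hv, huv⟩ : ∃ u m, l ++ [x] = u :: m ∧ nextSign l x.1 = u.1 ∧
        ∃ v n, shiftGaps l x.1 ++ [y] = v :: n ∧ u.1 = v.1 := by
      rcases l with _ | ⟨u, l⟩
      · exact ⟨x, [], rfl, rfl, y, [], rfl, hxy⟩
      · exact ⟨u, l ++ [x], rfl, rfl, _, _, rfl, rfl⟩
    rw [shiftGaps, cons_append]
    rw [cons_append, hu, isChain_cons_cons] at h
    rw [hv] at h1 ⊢
    rw [isChain_cons_cons]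
    refine ⟨?_, h1⟩
    have h2 := h.1
    unfold GapFit at h2 ⊢
    rw [hw, ← huv]
    intro hne
    simp only at hne ⊢
    rw [gapShift, if_neg hne, add_zero]
    exact h2 hne

theorem countP_zero_gapWord (l : List (Bool × ℤ)) :
    (gapWord l).countP (fun x => x.1 = 0) = l.length := by
  induction l with
  | nil => rfl
  | cons x l ih => simp [gapWord_cons, gapLetters, ih, List.countP_replicate]

theorem countP_one_gapWord (l : List (Bool × ℤ)) :
    (gapWord l).countP (fun x => x.1 = 1) = (l.map fun x => x.2.natAbs).sum := by
  induction l with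
  | nil => rfl
  | cons x l ih => simp [gapWord_cons, gapLetters, ih, List.countP_replicate]

/-- The number of opposite pairs at the ends of a gap. -/
def gapTurns (e : Bool) (k : ℤ) (e' : Bool) : ℕ :=
  if k = 0 then 0 else (decide (e ≠ decide (0 ≤ k))).toNat + (decide (decide (0 ≤ k) ≠ e')).toNat

/-- The number of opposite pairs in a gap word followed by `a^z`. -/
def turns : List (Bool × ℤ) → Bool → ℕ
  | [], _ => 0
  | x :: l, z => gapTurns x.1 x.2 (nextSign l z) + turns l z

theorem pairCount_replicate_append {β : Type*} (p : β → β → Bool) (x : β) (hx : p x x = false)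
    (n : ℕ) (m : List β) (z : β) :
    pairCount p (List.replicate (n + 1) x ++ m) z =
      (p x (m.headD z)).toNat + pairCount p m z := by
  induction n with
  | zero => rfl
  | succ n ih =>
    rw [List.replicate_succ, cons_append, pairCount, ih]
    simp [List.replicate_succ, hx]

theorem headD_gapWord (l : List (Bool × ℤ)) (z : Bool) :
    (gapWord l).headD (0, z) = (0, nextSign l z) := by
  cases l <;> rfl

theorem pairCount_opposite_gapWord (l : List (Bool × ℤ)) (z : Bool) :
    pairCount opposite (gapWord l) (0, z) = turns l z := by
  induction l with
  | nil => rfl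
  | cons x l ih =>
    rw [gapWord_cons, pairCount, turns, ← ih]
    rcases Nat.eq_zero_or_pos x.2.natAbs with h0 | h0
    · have : x.2 = 0 := by omega
      rw [this, show gapLetters 0 = [] from rfl, nil_append, headD_gapWord]
      simp [gapTurns, opposite]
    · obtain ⟨n, hn⟩ : ∃ n, x.2.natAbs = n + 1 := ⟨x.2.natAbs - 1, by omega⟩
      have hne : x.2 ≠ 0 := by omega
      rw [gapLetters, hn, pairCount_replicate_append _ _ (by simp [opposite]), headD_gapWord,
        List.replicate_succ, cons_append, List.headD_cons]
      simp [gapTurns, hne, opposite, add_assoc]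

theorem gapTurns_shift_le (e e' : Bool) (k : ℤ) :
    gapTurns e (k + gapShift e e') e' ≤ gapTurns e k e' := by
  by_cases hk : 0 ≤ k
  · rcases eq_or_lt_of_le hk with rfl | hk'
    · cases e <;> cases e' <;> simp [gapTurns, gapShift]
    · have h1 : (0 : ℤ) ≤ k + 1 := by omega
      have h2 : k + 1 ≠ 0 := by omega
      have h3 : (0 : ℤ) ≤ k + -1 := by omega
      cases e <;> cases e' <;> simp [gapTurns, gapShift, hk, hk'.ne', h1, h2, h3]
      split_ifs <;> simp
  · have h0 : k ≠ 0 := by omega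
    have h1 : ¬ (0 : ℤ) ≤ k + -1 := by omega
    have h2 : k + -1 ≠ 0 := by omega
    cases e <;> cases e' <;> simp [gapTurns, gapShift, hk, h0, h1, h2]
    by_cases h3 : k + 1 = 0
    · simp [h3]
    · have := Bool.toNat_le (decide (k + 1 < 0))
      simp [h3]
      omega

/-- Without turns the gap grows by one, with one turn it keeps its length, with two turns it shrinks
by one. -/
theorem natAbs_shift (e e' : Bool) (k : ℤ) (h : e ≠ e' → k ≠ 0) :
    (k + gapShift e e').natAbs + gapTurns e k e' = k.natAbs + 1 := by
  by_cases h0 : k = 0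
  · subst h0
    cases e <;> cases e' <;> simp [gapTurns, gapShift] at h ⊢
  · by_cases hk : 0 ≤ k <;> cases e <;> cases e' <;> simp [gapTurns, gapShift, hk, h0] <;> omega

theorem turns_shiftGaps_le (l : List (Bool × ℤ)) (z : Bool) :
    turns (shiftGaps l z) z ≤ turns l z := by
  induction l with
  | nil => rfl
  | cons x l ih =>
    have : nextSign (shiftGaps l z) z = nextSign l z := by cases l <;> rfl
    rw [shiftGaps, turns, turns, this]
    exact Nat.add_le_add (gapTurns_shift_le _ _ _) ih

theorem sum_natAbs_shiftGaps {l : List (Bool × ℤ)} {x : Bool × ℤ}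
    (h : (l ++ [x]).IsChain GapFit) :
    ((shiftGaps l x.1).map fun x => x.2.natAbs).sum + turns l x.1 =
      (l.map fun x => x.2.natAbs).sum + l.length := by
  induction l with
  | nil => rfl
  | cons w l ih =>
    have h1 := ih h.tail
    have h2 : w.1 ≠ nextSign l x.1 → w.2 ≠ 0 := by
      rcases l with _ | ⟨u, l⟩
      · simp only [cons_append, nil_append, isChain_cons_cons] at h
        exact h.1
      · simp only [cons_append, isChain_cons_cons] at h
        exact h.1
    have h3 := natAbs_shift w.1 (nextSign l x.1) w.2 h2
    simp only [shiftGaps, List.map_cons, List.sum_cons, turns, List.length_cons]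
    omega

theorem length_shiftGaps (l : List (Bool × ℤ)) (z : Bool) :
    (shiftGaps l z).length = l.length := by
  induction l with
  | nil => rfl
  | cons x l ih => simp [shiftGaps, ih]

theorem IsCyclicallyReduced.swap_append {α : Type*} {l m : List (α × Bool)}
    (h : IsCyclicallyReduced (l ++ m)) : IsCyclicallyReduced (m ++ l) := by
  rcases l with _ | ⟨x, l⟩
  · simpa using h
  rcases m with _ | ⟨y, m⟩
  · simpa using h
  obtain ⟨h1, h2⟩ := h
  unfold IsReduced at h1
  rw [List.isChain_append] at h1
  constructor
  · unfold IsReduced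
    rw [List.isChain_append]
    refine ⟨h1.2.1, h1.1, fun a ha b hb => h2 a ?_ b ?_⟩
    · rwa [List.getLast?_append_of_ne_nil _ (by simp)]
    · simpa using hb
  · intro a ha b hb
    rw [List.getLast?_append_of_ne_nil _ (by simp)] at ha
    exact h1.2.2 a ha b (by simpa using hb)

/-- The strict bound by `m` provides an `a`-letter; rotate the cyclic word so that it starts there.
-/
theorem HasProfile.exists_gapWord {p : Fin 2 × Bool → Fin 2 × Bool → Bool}
    {g : FreeGroup (Fin 2)} {m n : ℕ} (H : HasProfile p g m n) :
    ∃ x l, (x :: l ++ [x]).IsChain GapFit ∧ (∃ h, g = h * mk (gapWord (x :: l)) * h⁻¹) ∧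
      (x :: l).length = m ∧ ((x :: l).map fun x => x.2.natAbs).sum = n ∧
      pairCount p (gapWord (x :: l)) (0, x.1) < m ∧
      pairCount p (gapWord (x :: l)) (0, x.1) < n := by
  obtain ⟨l, h1, ⟨h, rfl⟩, h3, h4, h5, h6⟩ := H
  have hpos : 0 < l.countP (fun x => x.1 = 0) := by
    rw [h3]; exact (Nat.zero_le _).trans_lt (h5 (0, true))
  obtain ⟨⟨i, e⟩, hmem, hi⟩ := List.countP_pos_iff.1 hpos
  simp only [decide_eq_true_eq] at hi
  subst hi
  obtain ⟨l₁, l₂, rfl⟩ := List.append_of_mem hmem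
  have hr := h1.swap_append
  obtain ⟨k, w, hw⟩ := exists_eq_gapLetters_append hr.isReduced
  rcases Nat.eq_zero_or_pos k.natAbs with hk | hk
  swap
  · obtain ⟨j, hj⟩ : ∃ j, k.natAbs = j + 1 := ⟨k.natAbs - 1, by omega⟩
    rw [gapLetters, hj, List.replicate_succ] at hw
    simp at hw
  rw [gapLetters, hk, List.replicate_zero, nil_append] at hw
  rcases w with _ | ⟨x, w⟩
  · simp at hw
  have hx : x.1 = e := by
    rw [gapWord_cons, cons_append] at hw
    simp only [cons.injEq, Prod.mk.injEq, true_and] at hw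
    exact hw.1.symm
  have hpc : ∀ z, pairCount p (l₁ ++ (0, e) :: l₂) ((l₁ ++ (0, e) :: l₂).headD z) =
      pairCount p (gapWord (x :: w)) (0, x.1) := by
    intro z
    rw [← pairCount_rotate p (0, e) l₂ l₁ z z, hw]
    rfl
  have hcount : ∀ q : Fin 2 × Bool → Bool, (l₁ ++ (0, e) :: l₂).countP q =
      (gapWord (x :: w)).countP q := by
    intro q
    rw [← hw, countP_append, countP_append, add_comm]
  refine ⟨x, w, ?_, ⟨h * mk l₁, ?_⟩, ?_, ?_, ?_, ?_⟩
  · apply isChain_of_isReduced_gapWord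
    rw [hw] at hr
    exact SyncCode.isReduced_append_head hr
  · rw [← hw, ← mul_mk, ← mul_mk]
    group
  · rw [← h3, hcount, countP_zero_gapWord]
  · rw [← h4, hcount, countP_one_gapWord]
  · rw [← hpc (0, true)]; exact h5 _
  · rw [← hpc (0, true)]; exact h6 _

/-- The number of `b`-letters grows by `m` minus the number of turns, which is positive. Turns do
not increase, so the property persists and the step can be iterated. -/
theorem HasProfile.transvection_apply {g : FreeGroup (Fin 2)} {m n : ℕ}
    (H : HasProfile opposite g m n) :
    ∃ n' > n, HasProfile opposite (transvection g) m n' := by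
  obtain ⟨x, l, h1, ⟨h, rfl⟩, h3, h4, h5, h6⟩ := H.exists_gapWord
  rw [pairCount_opposite_gapWord] at h5 h6
  have hs := sum_natAbs_shiftGaps h1
  have ht := turns_shiftGaps_le (x :: l) x.1
  have hmk := transvection_mk_gapWord (x :: l) x.1
  have hn : nextSign (x :: l) x.1 = x.1 := rfl
  rw [hn] at hmk
  have hn' : ((shiftGaps (x :: l) x.1).map fun x => x.2.natAbs).sum > n := by omega
  have hhead : ∀ z, (gapWord (shiftGaps (x :: l) x.1)).headD z = (0, x.1) := fun z => rfl
  refine ⟨_, hn', gapWord (shiftGaps (x :: l) x.1), ?_,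
    ⟨transvection h * (if x.1 then 1 else (of 1)⁻¹), ?_⟩, ?_, ?_, fun z => ?_, fun z => ?_⟩
  · exact isCyclicallyReduced_gapWord (isChain_shiftGaps h1 rfl)
  · rw [← eq_mul_inv_iff_mul_eq] at hmk
    rw [_root_.map_mul, _root_.map_mul, hmk, _root_.map_inv]
    group
  · rw [countP_zero_gapWord, length_shiftGaps, h3]
  · rw [countP_one_gapWord]
  · rw [hhead, pairCount_opposite_gapWord]; omega
  · rw [hhead, pairCount_opposite_gapWord]; omega

theorem HasProfile.exchange_apply {g : FreeGroup (Fin 2)} {m n : ℕ}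
    (H : HasProfile opposite g m n) : HasProfile opposite (exchange g) n m :=
  (H.signedPerm_apply (Equiv.swap 0 1) (fun _ => true) (by
    intro x y; simp [opposite, signedLetter])).2 (by simp)

theorem HasProfile.positive_apply {M : MulAut (FreeGroup (Fin 2))} (hM : M ∈ positiveMonoid) :
    M = 1 ∨ ∀ g m n, HasProfile opposite g m n →
      ∃ m' n', m + n < m' + n' ∧ HasProfile opposite (M g) m' n' := by
  induction hM using Submonoid.closure_induction_left with
  | one => exact Or.inl rfl
  | mul_left t ht M hM ih =>
    right
    intro g m n H
    obtain ⟨m₁, n₁, h1, H1⟩ : ∃ m' n', m + n ≤ m' + n' ∧ HasProfile opposite (M g) m' n' := by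
      rcases ih with rfl | ih
      · exact ⟨m, n, le_rfl, H⟩
      · obtain ⟨m', n', h, H'⟩ := ih g m n H
        exact ⟨m', n', h.le, H'⟩
    rcases ht with rfl | rfl
    · obtain ⟨n', hn', H'⟩ := H1.transvection_apply
      exact ⟨m₁, n', by omega, H'⟩
    · obtain ⟨m', hm', H'⟩ := H1.exchange_apply.transvection_apply
      exact ⟨m', n₁, by omega, H'.exchange_apply⟩

/-- The total length in a profile is invariant under conjugation and isometries. -/
theorem HasProfile.add_eq_add {p q : Fin 2 × Bool → Fin 2 × Bool → Bool}
    {g k : FreeGroup (Fin 2)} {m n m' n' : ℕ} (H : HasProfile p g m n)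
    {P : MulAut (FreeGroup (Fin 2))} (hP : P ∈ isometries (Fin 2))
    (H' : HasProfile q (k * P g * k⁻¹) m' n') : m + n = m' + n' := by
  obtain ⟨π, e, rfl⟩ := eq_signedPerm_of_mem_isometries hP
  have hlen : ∀ l : List (Fin 2 × Bool),
      l.countP (fun x => x.1 = 0) + l.countP (fun x => x.1 = 1) = l.length := by
    intro l
    induction l with
    | nil => rfl
    | cons x l ih =>
      obtain ⟨i, e⟩ := x
      fin_cases i <;> simp <;> omega
  obtain ⟨l, h1, ⟨h, rfl⟩, rfl, rfl, -, -⟩ := H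
  obtain ⟨l', h1', ⟨h', h2'⟩, rfl, rfl, -, -⟩ := H'
  rw [hlen, hlen]
  have := countP_eq_of_conj h1' (h1.map_signedLetter π e) (g := h'⁻¹ * k * signedPerm π e h) (by
    rw [_root_.map_mul, _root_.map_mul, signedPerm_mk, _root_.map_inv] at h2'
    calc mk l' = h'⁻¹ * (h' * mk l' * h'⁻¹) * h' := by group
      _ = _ := by rw [← h2']; group) (fun _ => true)
  simpa using this.symm

/-- `changing` ignores signs, so it survives the signed permutation `Q`, as `opposite` might not. It
then implies the condition on `opposite` under which `M` strictly increases length. -/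
theorem HasProfile.eq_or_lt {g : FreeGroup (Fin 2)} {m n m' n' : ℕ} (H : HasProfile changing g m n)
    (δ : MulAut (FreeGroup (Fin 2))) (H' : HasProfile changing (δ g) m' n') :
    (∃ h, ∃ s ∈ isometries (Fin 2), δ = MulAut.conj h * s) ∨ m + n < m' + n' := by
  obtain ⟨h, P, hP, M, hM, Q, hQ, rfl⟩ := isPositivelyDecomposed δ
  rcases HasProfile.positive_apply hM with rfl | hgrow
  · left
    exact ⟨h, P * Q, mul_mem hP hQ, by simp only [mul_assoc, one_mul]⟩
  · right
    have hQg : ∃ m₁ n₁, m + n = m₁ + n₁ ∧ HasProfile changing (Q g) m₁ n₁ := by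
      obtain ⟨π, e, rfl⟩ := eq_signedPerm_of_mem_isometries hQ
      have hs := H.signedPerm_apply π e (by
        intro x y; simp [changing, signedLetter])
      rcases (show π 0 = 0 ∨ π 0 = 1 by omega) with h0 | h0
      · exact ⟨m, n, rfl, hs.1 h0⟩
      · exact ⟨n, m, add_comm _ _, hs.2 h0⟩
    obtain ⟨m₁, n₁, h1, H1⟩ := hQg
    obtain ⟨m₂, n₂, h2, H2⟩ := hgrow _ _ _ (H1.mono (q := opposite) (by
      intro x y; simp only [opposite, changing, decide_eq_true_eq]; exact And.left))
    have := H2.add_eq_add hP (k := h) (q := changing) H'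
    omega

/-- An automorphism mapping an element of small complexity to another such element is a signed
permutation of the generators up to conjugation. -/
theorem HasProfile.exists_eq_conj_mul {g : FreeGroup (Fin 2)} {m n m' n' : ℕ}
    (H : HasProfile changing g m n) (δ : MulAut (FreeGroup (Fin 2)))
    (H' : HasProfile changing (δ g) m' n') :
    ∃ h, ∃ s ∈ isometries (Fin 2), δ = MulAut.conj h * s := by
  rcases H.eq_or_lt δ H' with h | hlt
  · exact h
  -- Growth under both `δ` and `δ⁻¹` is contradictory.
  · rcases H'.eq_or_lt δ⁻¹ (m' := m) (n' := n) (by rwa [MulAut.inv_apply_self]) with h | hlt'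
    · obtain ⟨h, s, hs, he⟩ := h
      refine ⟨s⁻¹ h⁻¹, s⁻¹, inv_mem hs, ?_⟩
      rw [← inv_inv δ, he, mul_inv_rev, ← _root_.map_inv, mul_conj_eq]
    · omega

end FreeGroup

/-! ### Signed permutations and properties of codes checked factor by factor. -/

namespace FreeGroup

open List

theorem pairCount_changing_gapWord (l : List (Bool × ℤ)) (z : Bool) :
    pairCount changing (gapWord l) (0, z) = 2 * l.countP (fun x => x.2 ≠ 0) := by
  induction l with
  | nil => rfl
  | cons x l ih =>
    rw [gapWord_cons, pairCount]
    rcases Nat.eq_zero_or_pos x.2.natAbs with h0 | h0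
    · have : x.2 = 0 := by omega
      rw [this, show gapLetters 0 = [] from rfl, nil_append, headD_gapWord, ih,
        List.countP_cons]
      simp [changing, this]
    · obtain ⟨n, hn⟩ : ∃ n, x.2.natAbs = n + 1 := ⟨x.2.natAbs - 1, by omega⟩
      have hne : x.2 ≠ 0 := by omega
      rw [gapLetters, hn, pairCount_replicate_append _ _ (by simp [changing]), headD_gapWord,
        List.replicate_succ, cons_append, List.headD_cons, ih, List.countP_cons]
      simp [hne, changing]
      ring

theorem map_signedLetter_gapWord {π : Equiv.Perm (Fin 2)} (h0 : π 0 = 0) (e : Fin 2 → Bool)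
    (l : List (Bool × ℤ)) : (gapWord l).map (signedLetter π e) =
      gapWord (l.map fun x => (x.1 == e 0, sgn (e 1) * x.2)) := by
  have h1 : π 1 = 1 := by
    have hne : π 0 ≠ π 1 := fun h => by simpa using π.injective h
    omega
  induction l with
  | nil => rfl
  | cons x l ih =>
    rw [gapWord_cons, List.map_cons, List.map_append, ih, List.map_cons, gapWord_cons]
    congr 1
    · simp [signedLetter, h0]
    · congr 1
      have habs : (sgn (e 1) * x.2).natAbs = x.2.natAbs := by cases e 1 <;> simp
      rw [gapLetters, gapLetters, habs, List.map_replicate]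
      rcases Nat.eq_zero_or_pos x.2.natAbs with hx | hx
      · simp [hx]
      · congr 1
        have hne : x.2 ≠ 0 := by omega
        simp only [signedLetter, h1, Prod.mk.injEq, true_and]
        cases e 1 <;> simp
        by_cases h2 : x.2 ≤ 0 <;> by_cases h3 : 0 ≤ x.2 <;> simp [h2, h3]
        all_goals omega

namespace SyncCode

variable {ι : Type} (S : SyncCode ι)

theorem exists_of_mem_code {l : List (ι × Bool)} {z : ι × Bool} (h : IsReduced (l ++ [z]))
    {x : Bool × ℤ} (hx : x ∈ S.code l z) :
    ∃ s t, (s.1 = t.1 → s.2 = t.2) ∧ x ∈ S.head s :: S.tail s t := by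
  induction l with
  | nil => simp [code] at hx
  | cons s l ih =>
    rw [code_cons, ← cons_append, List.mem_append] at hx
    rcases hx with hx | hx
    · exact ⟨s, _, headD_rel h, hx⟩
    · exact ih (isReduced_of_cons h) hx

theorem isChain_filter_code {R : Bool × ℤ → Bool × ℤ → Prop} {p : Bool × ℤ → Bool}
    (hR : ∀ s t, (s.1 = t.1 → s.2 = t.2) →
      ((S.head s :: S.tail s t).filter p ++ [S.head t]).IsChain R) (hp : ∀ s, p (S.head s))
    {l : List (ι × Bool)} {z : ι × Bool} (h : IsReduced (l ++ [z])) :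
    ((S.code l z).filter p ++ [S.head z]).IsChain R := by
  induction l with
  | nil => simp [code]
  | cons s l ih =>
    have h1 := ih (isReduced_of_cons h)
    have h2 := hR _ _ (headD_rel h)
    rw [code_cons, ← cons_append, List.filter_append, append_assoc]
    obtain ⟨r, hr⟩ : ∃ r, (S.code l z).filter p ++ [S.head z] = [S.head (l.headD z)] ++ r := by
      rcases l with _ | ⟨t, l⟩
      · exact ⟨[], rfl⟩
      · rw [code_cons, List.filter_cons_of_pos (hp t)]
        exact ⟨_, rfl⟩
    rw [hr] at h1 ⊢
    rw [← append_assoc]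
    exact h2.append_overlap h1 (by simp)

end SyncCode

end FreeGroup

/-! ### Rigidity of the words in `L`. -/

namespace SeedSubgroup

open List

open FreeGroup

/-- The gap word is balanced: each gap which is nonzero is long and is accompanied by two zero
gaps. -/
def Balanced (l : List (Bool × ℤ)) : Prop :=
  l.length = 3 * l.countP (fun x => x.2 ≠ 0) ∧ l.length ≤ (l.map fun x => x.2.natAbs).sum

theorem Balanced.append {l m : List (Bool × ℤ)} (hl : Balanced l) (hm : Balanced m) :
    Balanced (l ++ m) := by
  unfold Balanced at *
  rw [length_append, countP_append, map_append, sum_append]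
  omega

theorem balanced_three {e e' e'' : Bool} {k : ℤ} (hk : 3 ≤ k.natAbs) :
    Balanced [(e, k), (e', 0), (e'', 0)] := by
  have : k ≠ 0 := by omega
  simp [Balanced, this, hk]

theorem balanced_flatMap {n : ℕ} {f : ℕ → List (Bool × ℤ)} (h : ∀ j < n, Balanced (f j)) :
    Balanced ((List.range n).flatMap f) := by
  induction n with
  | zero => simp [Balanced]
  | succ n ih =>
    rw [List.range_succ, List.flatMap_append]
    exact (ih fun j hj => h j (by omega)).append (by simpa using h n (by omega))

theorem three_le_start (r : ℕ) (i : Fin 2) : 3 ≤ start r i := by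
  unfold start; split_ifs <;> omega

theorem balanced_middle (r : ℕ) (s : Fin 2 × Bool) : Balanced (middle r s) := by
  have := three_le_start r s.1
  unfold middle
  split_ifs
  · exact balanced_flatMap fun j _ => balanced_three (by push_cast; omega)
  · exact balanced_flatMap fun j _ => balanced_three (by push_cast; omega)

theorem start_sub_start (r : ℕ) {i j : Fin 2} (h : i ≠ j) :
    ((start r i : ℤ) - start r j).natAbs = r + 3 := by
  fin_cases i <;> fin_cases j <;> simp_all [start] <;> omega

theorem balanced_junction (r : ℕ) {s t : Fin 2 × Bool} (h : s.1 = t.1 → s.2 = t.2) :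
    Balanced (junction r s t) := by
  have h1 := three_le_start r s.1
  have h2 := three_le_start r t.1
  rcases s with ⟨i, _ | _⟩ <;> rcases t with ⟨j, _ | _⟩
  · exact (balanced_three (by simp only at *; omega)).append
      (balanced_three (by simp only at *; omega))
  · refine balanced_three ?_
    rw [start_sub_start]
    · omega
    · rintro rfl; simp at h
  · refine balanced_three ?_
    rw [start_sub_start]
    · omega
    · rintro rfl; simp at h
  · exact (balanced_three (by simp only at *; omega)).append
      (balanced_three (by simp only at *; omega))

theorem four_le_headGap (r : ℕ) (s : Fin 2 × Bool) : 4 ≤ (headGap r s).natAbs := by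
  have := three_le_start r s.1
  unfold headGap; split_ifs <;> omega

theorem seedCode_head (r : ℕ) (hr : 2 ≤ r) (s : Fin 2 × Bool) :
    (seedCode r hr).head s = (s.2, headGap r s) := rfl

theorem seedCode_tail (r : ℕ) (hr : 2 ≤ r) (s t : Fin 2 × Bool) :
    (seedCode r hr).tail s t = [(s.2, 0), (s.2, 0)] ++ middle r s ++ junction r s t := rfl

theorem balanced_block {r : ℕ} (hr : 2 ≤ r) {s t : Fin 2 × Bool} (h : s.1 = t.1 → s.2 = t.2) :
    Balanced ((seedCode r hr).head s :: (seedCode r hr).tail s t) := by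
  have h3 := balanced_three (e := s.2) (e' := s.2) (e'' := s.2)
    ((by omega : 3 ≤ 4).trans (four_le_headGap r s))
  have := (h3.append (balanced_middle r s)).append (balanced_junction r h)
  rw [seedCode_head, seedCode_tail]
  simpa using this

theorem balanced_code {r : ℕ} (hr : 2 ≤ r) {l : List (Fin 2 × Bool)} {z : Fin 2 × Bool}
    (h : IsReduced (l ++ [z])) : Balanced ((seedCode r hr).code l z) := by
  induction l with
  | nil => simp [SyncCode.code, Balanced]
  | cons s l ih =>
    rw [SyncCode.code_cons, ← cons_append]
    exact (balanced_block hr (SyncCode.headD_rel h)).append (ih (SyncCode.isReduced_of_cons h))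

/-- Strictness comes from the first three entries, which contain at least four `b`-letters; balance
bounds the rest. -/
theorem length_code_lt {r : ℕ} (hr : 2 ≤ r) {s : Fin 2 × Bool} {l : List (Fin 2 × Bool)}
    (h : IsReduced (s :: l ++ [s])) : ((seedCode r hr).code (s :: l) s).length <
      (((seedCode r hr).code (s :: l) s).map fun x => x.2.natAbs).sum := by
  have h1 := (balanced_middle r s).2
  have h2 := (balanced_junction r (SyncCode.headD_rel h)).2
  have h3 := (balanced_code hr (SyncCode.isReduced_of_cons h)).2
  have h4 := four_le_headGap r s
  rw [SyncCode.code_cons, seedCode_head, seedCode_tail]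
  simp only [length_cons, length_append, map_cons, map_append, sum_cons, sum_append, map_nil,
    length_nil, sum_nil, Int.natAbs_zero]
  omega

/-- Each nonzero gap makes two changes of type and one entry in three is nonzero, so changes number
two thirds of the `a`-letters. -/
theorem hasProfile_code {r : ℕ} (hr : 2 ≤ r) {s : Fin 2 × Bool} {l : List (Fin 2 × Bool)}
    (h : IsCyclicallyReduced (s :: l)) (g : FreeGroup (Fin 2)) :
    HasProfile changing (g * mk (gapWord ((seedCode r hr).code (s :: l) s)) * g⁻¹)
      ((seedCode r hr).code (s :: l) s).length
      (((seedCode r hr).code (s :: l) s).map fun x => x.2.natAbs).sum := by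
  have hred := SyncCode.isReduced_append_head h
  have hb := balanced_code hr hred
  have hlt := length_code_lt hr hred
  have hpos : 0 < ((seedCode r hr).code (s :: l) s).length := by simp [SyncCode.code_cons]
  have hpc : ∀ z, pairCount changing (gapWord ((seedCode r hr).code (s :: l) s))
      ((gapWord ((seedCode r hr).code (s :: l) s)).headD z) =
      2 * ((seedCode r hr).code (s :: l) s).countP (fun x => x.2 ≠ 0) :=
    fun z => pairCount_changing_gapWord _ _
  have h1 := hb.1
  refine ⟨_, isCyclicallyReduced_gapWord ((seedCode r hr).isChain_code_append h), ⟨g, rfl⟩,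
    countP_zero_gapWord _, countP_one_gapWord _, fun z => ?_, fun z => ?_⟩
  · rw [← SyncCode.code_cons, hpc]; omega
  · rw [← SyncCode.code_cons, hpc]; omega

/-- No gap is followed by the next smaller one. -/
def NoDescent (x y : Bool × ℤ) : Prop := x.1 = y.1 → y.2 ≠ x.2 - 1

theorem isChain_noDescent_range (e : Bool) (c : ℤ) (n : ℕ) (l : List (Bool × ℤ))
    (h : ((e, c + n) :: l).IsChain NoDescent) :
    ((e, c) :: ((List.range n).map fun j : ℕ => (e, c + 1 + j)) ++ l).IsChain NoDescent := by
  induction n generalizing l with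
  | zero => simpa using h
  | succ n ih =>
    rw [List.range_succ, List.map_append, ← cons_append, append_assoc]
    apply ih
    rw [List.map_singleton, singleton_append, isChain_cons_cons]
    refine ⟨fun _ => by simp only; omega, ?_⟩
    convert h using 3
    push_cast
    ring

theorem filter_middle {r : ℕ} (s : Fin 2 × Bool) :
    (middle r s).filter (fun x => x.2 ≠ 0) =
      (List.range r).map fun j : ℕ => (s.2, headGap r s + 1 + j) := by
  have key : ∀ (n : ℕ) (e : Bool) (f g : ℕ → ℤ), (∀ j < n, f j = g j ∧ f j ≠ 0) →
      ((List.range n).flatMap fun j => triple e (f j)).filter (fun x => x.2 ≠ 0) =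
        (List.range n).map fun j => (e, g j) := by
    intro n e f g h
    induction n with
    | zero => rfl
    | succ n ih =>
      rw [List.range_succ, List.flatMap_append, List.filter_append, List.map_append,
        ih fun j hj => h j (by omega)]
      have := h n (by omega)
      simp [triple, this.1 ▸ this.2, this.1]
  have := three_le_start r s.1
  rcases s with ⟨i, _ | _⟩
  · simp only [middle, headGap, Bool.false_eq_true, if_false, descending]
    exact key r false _ _ fun j hj => by push_cast; omega
  · simp only [middle, headGap, if_true, ascending]
    exact key r true _ _ fun j hj => by push_cast; omega

theorem filter_front (r : ℕ) (s : Fin 2 × Bool) :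
    ((s.2, headGap r s) :: ([(s.2, 0), (s.2, 0)] ++ middle r s)).filter (fun x => x.2 ≠ 0) =
      (s.2, headGap r s) :: (List.range r).map fun j : ℕ => (s.2, headGap r s + 1 + j) := by
  have := four_le_headGap r s
  have h0 : headGap r s ≠ 0 := by omega
  rw [List.filter_cons_of_pos (by simpa using h0), List.filter_append, filter_middle]
  simp

theorem filter_triple {e : Bool} {k : ℤ} (h : k ≠ 0) :
    (triple e k).filter (fun x => x.2 ≠ 0) = [(e, k)] := by
  simp [triple, h]

/-- Gaps climb by one in inverse generators too, since inversion reverses the order and negates.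
What remains is a finite check at the junctions. -/
theorem isChain_noDescent_block {r : ℕ} (hr : 2 ≤ r) (s t : Fin 2 × Bool)
    (h : s.1 = t.1 → s.2 = t.2) :
    (((seedCode r hr).head s :: (seedCode r hr).tail s t).filter (fun x => x.2 ≠ 0) ++
      [(seedCode r hr).head t]).IsChain NoDescent := by
  rw [seedCode_head, seedCode_head, seedCode_tail, ← cons_append, List.filter_append, filter_front,
    append_assoc]
  apply isChain_noDescent_range
  obtain ⟨i, e⟩ := s
  obtain ⟨j, e'⟩ := t
  have h1 := three_le_start r i
  have h2 := three_le_start r j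
  cases e <;> cases e'
  · have e1 : (start r i : ℤ) ≠ 0 := by omega
    have e2 : (-((start r j : ℤ) + r + 2)) ≠ 0 := by omega
    have : (junction r (i, false) (j, false)).filter (fun x => x.2 ≠ 0) =
        [(false, -(start r i : ℤ)), (false, -((start r j : ℤ) + r + 2))] := by
      simp only [junction]
      rw [List.filter_append, filter_triple (by omega), filter_triple (by omega)]
      rfl
    rw [this]
    simp only [headGap, cons_append, nil_append, isChain_cons_cons, isChain_singleton, NoDescent,
      Bool.false_eq_true, if_false]
    fin_cases i <;> fin_cases j <;> simp [start] <;> omega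
  · have hij : i ≠ j := by rintro rfl; simp at h
    have e1 := start_sub_start r hij.symm
    have : (junction r (i, false) (j, true)).filter (fun x => x.2 ≠ 0) =
        [(false, (start r j : ℤ) - start r i)] := by
      simp [junction, List.filter_cons]
      omega
    rw [this]
    simp only [headGap, cons_append, nil_append, isChain_cons_cons, isChain_singleton, NoDescent,
      Bool.false_eq_true, if_false]
    fin_cases i <;> fin_cases j <;> simp [start] at hij ⊢ <;> omega
  · have hij : i ≠ j := by rintro rfl; simp at h
    have e1 := start_sub_start r hij
    have : (junction r (i, true) (j, false)).filter (fun x => x.2 ≠ 0) =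
        [(true, (start r i : ℤ) - start r j)] := by
      simp [junction, List.filter_cons]
      omega
    rw [this]
    simp only [headGap, cons_append, nil_append, isChain_cons_cons, isChain_singleton, NoDescent,
      if_true]
    fin_cases i <;> fin_cases j <;> simp [start] at hij ⊢ <;> omega
  · have e1 : (start r j : ℤ) ≠ 0 := by omega
    have : (junction r (i, true) (j, true)).filter (fun x => x.2 ≠ 0) =
        [(true, (start r i : ℤ) + r + 2), (true, (start r j : ℤ))] := by
      simp only [junction]
      rw [List.filter_append, filter_triple (by omega), filter_triple (by omega)]
      rfl
    rw [this]
    simp only [headGap, cons_append, nil_append, isChain_cons_cons, isChain_singleton, NoDescent,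
      if_true]
    fin_cases i <;> fin_cases j <;> simp [start] <;> omega

theorem gap_of_mem_block {r : ℕ} (hr : 2 ≤ r) {s t : Fin 2 × Bool} (h : s.1 = t.1 → s.2 = t.2)
    {x : Bool × ℤ} (hx : x ∈ (seedCode r hr).head s :: (seedCode r hr).tail s t) :
    0 ≤ sgn x.1 * x.2 ∨ x.2.natAbs = r + 3 := by
  rw [seedCode_head, seedCode_tail, ← cons_append, List.mem_append] at hx
  have hs := three_le_start r s.1
  rcases hx with hx | hx
  · left
    by_cases h0 : x.2 = 0
    · simp [h0]
    have := (List.mem_filter (p := fun x => decide (x.2 ≠ 0))).2 ⟨hx, by simpa using h0⟩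
    rw [filter_front] at this
    simp only [mem_cons, mem_map, mem_range] at this
    obtain ⟨i, e⟩ := s
    rcases this with rfl | ⟨j, hj, rfl⟩ <;> cases e <;> simp [headGap] <;> omega
  · obtain ⟨i, e⟩ := s
    obtain ⟨j, e'⟩ := t
    have h2 := three_le_start r j
    cases e <;> cases e' <;> simp [junction, triple] at hx
    · rcases hx with rfl | rfl | rfl | rfl <;> simp <;> omega
    · have hij : j ≠ i := by rintro rfl; simp at h
      have := start_sub_start r hij
      rcases hx with rfl | rfl <;> simp only [this, or_true, mul_zero, le_refl, true_or]
    · have hij : i ≠ j := by rintro rfl; simp at h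
      have := start_sub_start r hij
      rcases hx with rfl | rfl <;> simp only [this, or_true, mul_zero, le_refl, true_or]
    · rcases hx with rfl | rfl | rfl | rfl <;> simp <;> omega

theorem natAbs_headGap_ne {r : ℕ} (hr : 2 ≤ r) (s : Fin 2 × Bool) :
    (headGap r s).natAbs ≠ r + 3 := by
  obtain ⟨i, e⟩ := s
  fin_cases i <;> cases e <;> simp [headGap, start] <;> omega

theorem sgn_mul_headGap_pos (r : ℕ) (s : Fin 2 × Bool) : 0 < sgn s.2 * headGap r s := by
  obtain ⟨i, e⟩ := s
  cases e <;> simp [headGap] <;> omega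

/-- Negating `b` turns the ascent at the front of a factor into a descent, which `NoDescent`
excludes. Negating only `a` gives a gap of sign opposite to its letter; such gaps have size `r + 3`,
which no head gap has. -/
theorem eq_true_of_infix {r : ℕ} (hr : 2 ≤ r) {l m : List (Fin 2 × Bool)} {z t : Fin 2 × Bool}
    (hl : IsReduced (l ++ [z])) (e₀ e₁ : Bool) {u v : List (Bool × ℤ)}
    (h : ((seedCode r hr).code l z).map (fun x => (x.1 == e₀, sgn e₁ * x.2)) =
      u ++ ((seedCode r hr).code (t :: m) t).dropLast ++ v) : e₀ = true ∧ e₁ = true := by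
  obtain ⟨w, hw⟩ : ∃ w, ((seedCode r hr).code (t :: m) t).dropLast =
      ((t.2, headGap r t) :: ([(t.2, 0), (t.2, 0)] ++ middle r t)) ++ w := by
    rw [SyncCode.code_cons, seedCode_head, seedCode_tail]
    have : ∀ (x : Bool × ℤ) (a b c : List (Bool × ℤ)), b ≠ [] →
        (x :: (a ++ b ++ c)).dropLast = (x :: a) ++ (b ++ c).dropLast := by
      intro x a b c hb
      rw [append_assoc, ← cons_append, List.dropLast_append_of_ne_nil (by simp [hb])]
    refine ⟨_, this _ _ _ _ ?_⟩
    rcases t with ⟨j, _ | _⟩ <;> rcases m.headD _ with ⟨k, _ | _⟩ <;> simp [junction, triple]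
  rw [hw] at h
  have hf := congrArg (List.filter fun x => x.2 ≠ 0) h
  simp only [List.filter_append] at hf
  rw [filter_front, List.filter_map] at hf
  have hcomp : ((fun x : Bool × ℤ => decide (x.2 ≠ 0)) ∘
      fun x : Bool × ℤ => (x.1 == e₀, sgn e₁ * x.2)) = fun x => decide (x.2 ≠ 0) := by
    funext x
    cases e₁ <;> simp
  rw [hcomp] at hf
  -- A nonempty middle part supplies the entry `headGap + 1` right after the head, zero gaps being
  -- ignored.
  obtain ⟨r', rfl⟩ : ∃ r', r = r' + 1 := ⟨r - 1, by omega⟩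
  rw [List.range_succ_eq_map] at hf
  simp only [List.map_cons, cons_append, append_assoc] at hf
  rw [List.map_eq_append_iff] at hf
  obtain ⟨a₁, a₂, ha, -, hf⟩ := hf
  rw [List.map_eq_cons_iff] at hf
  obtain ⟨x, a₃, rfl, hx, hf⟩ := hf
  rw [List.map_eq_cons_iff] at hf
  obtain ⟨y, a₄, rfl, hy, -⟩ := hf
  have hchain := (seedCode (r' + 1) hr).isChain_filter_code (isChain_noDescent_block hr)
    (fun s => by
      have := four_le_headGap (r' + 1) s
      rw [seedCode_head]
      simp only [decide_eq_true_eq, ne_eq]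
      omega) hl
  rw [ha] at hchain
  have hxy : NoDescent x y := by
    have : [x, y].IsChain NoDescent := hchain.infix ⟨a₁, a₄ ++ [(seedCode (r' + 1) hr).head z], by simp⟩
    simpa using this
  have hxmem : x ∈ (seedCode (r' + 1) hr).code l z := by
    have : x ∈ ((seedCode (r' + 1) hr).code l z).filter fun x => decide (x.2 ≠ 0) := by
      rw [ha]; simp
    exact (List.mem_filter.1 this).1
  obtain ⟨s₁, s₂, hs, hxb⟩ := (seedCode (r' + 1) hr).exists_of_mem_code hl hxmem
  have h1 := gap_of_mem_block hr hs hxb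
  have h2 := natAbs_headGap_ne hr t
  have h3 := sgn_mul_headGap_pos (r' + 1) t
  obtain ⟨x1, x2⟩ := x
  obtain ⟨y1, y2⟩ := y
  obtain ⟨i, e⟩ := t
  simp only [Prod.mk.injEq] at hx hy
  obtain ⟨hx1, hx2⟩ := hx
  obtain ⟨hy1, hy2⟩ := hy
  simp only [NoDescent] at hxy
  simp only at h1 h2 h3
  rw [← hx2] at h2 h3 hy2
  clear h hw hchain ha hxmem hxb hcomp
  cases e₀ <;> cases e₁ <;> cases x1 <;> cases y1 <;> cases e <;> simp at hx1 hy1 <;>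
    simp at * <;> omega

end SeedSubgroup

/-! ### Passing to subgroups, and conclusion. -/

namespace FreeGroup

open List

/-- The image of a malnormal subgroup under an injective homomorphism with malcharacteristic range
is malcharacteristic. -/
theorem isMalcharacteristic_range_comp {G H K : Type*} [Group G] [Group H] [Group K] {φ : G →* H}
    {ψ : H →* K} (hψ : Function.Injective ψ) (hm : ψ.range.IsMalcharacteristic)
    (hφ : ∀ f₁ f₂ : G, f₁ ≠ 1 → ∀ g, φ f₁ * g = g * φ f₂ → g ∈ φ.range) :
    (ψ.comp φ).range.IsMalcharacteristic := by
  intro δ hδ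
  obtain ⟨⟨x, ⟨y, ⟨f₁, rfl⟩, hy⟩, ⟨f₂, hf₂⟩⟩, hx1⟩ := Subgroup.ne_bot_iff_exists_ne_one.1 hδ
  change δ (ψ (φ f₁)) = x at hy
  change ψ (φ f₂) = x at hf₂
  have hconj : δ ∈ ψ.range.map (MulAut.conj : K →* MulAut K) := by
    apply hm
    rw [Subgroup.ne_bot_iff_exists_ne_one]
    exact ⟨⟨x, ⟨_, ⟨φ f₁, rfl⟩, hy⟩, ⟨φ f₂, hf₂⟩⟩,
      fun h => hx1 (Subtype.ext (congrArg Subtype.val h :))⟩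
  obtain ⟨_, ⟨h, rfl⟩, rfl⟩ := hconj
  have hf₁ : f₁ ≠ 1 := by
    rintro rfl
    apply hx1
    apply Subtype.ext
    change x = 1
    rw [← hy]
    simp
  have heq : φ f₁ * h⁻¹ = h⁻¹ * φ f₂ := by
    apply hψ
    have h1 : ψ h * ψ (φ f₁) * (ψ h)⁻¹ = ψ (φ f₂) := hy.trans hf₂.symm
    rw [_root_.map_mul, _root_.map_mul, ← h1, _root_.map_inv]
    group
  obtain ⟨k, hk⟩ := hφ _ _ hf₁ _ heq
  refine ⟨ψ h, ⟨k⁻¹, ?_⟩, rfl⟩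
  rw [MonoidHom.comp_apply, _root_.map_inv, hk, inv_inv]

theorem isFreeOfRank_range {ι : Type} {G : Type} [Group G] {φ : FreeGroup ι →* G}
    (hφ : Function.Injective φ) : IsFreeOfRank φ.range (Cardinal.mk ι) :=
  ⟨ι, rfl, ⟨FreeGroupBasis.ofRepr (MonoidHom.ofInjective hφ).symm⟩⟩

end FreeGroup

namespace SeedSubgroup

open List

open FreeGroup

theorem range_lift_seedCode (r : ℕ) (hr : 2 ≤ r) :
    (lift (seedCode r hr).w).range = L (r + 3) := by
  rw [range_lift_eq_closure, L]
  congr 1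
  ext x
  simp only [Set.mem_range, Fin.exists_fin_two, Set.mem_insert_iff, Set.mem_singleton_iff]
  change block (start r 0) (r + 3) = x ∨ block (start r 1) (r + 3) = x ↔ _
  rw [omegaX, omegaY, eq_comm, eq_comm (a := block (start r 1) _)]
  rfl

/-- Profiles reduce `δ` to a conjugation times a signed permutation, letter counts and gap patterns
make the permutation trivial, and malnormality locates the conjugator. -/
theorem mem_range_of_apply_eq {r : ℕ} (hr : 2 ≤ r) {f₁ f₂ : FreeGroup (Fin 2)} (hf : f₁ ≠ 1)
    {δ : MulAut (FreeGroup (Fin 2))}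
    (h : δ (lift (seedCode r hr).w f₁) = lift (seedCode r hr).w f₂) :
    δ ∈ (lift (seedCode r hr).w).range.map (MulAut.conj : FreeGroup (Fin 2) →* _) := by
  set S := seedCode r hr with hS
  have hf₂ : f₂ ≠ 1 := by
    rintro rfl
    rw [_root_.map_one, map_eq_one_iff δ δ.injective,
      map_eq_one_iff _ S.lift_injective] at h
    exact hf h
  obtain ⟨p, s, l, hs, hp⟩ := exists_conj_cyclicallyReduced hf
  obtain ⟨q, t, m, ht, hq⟩ := exists_conj_cyclicallyReduced hf₂
  have h₁ : lift S.w f₁ = (lift S.w p * S.pre s) * mk (gapWord (S.code (s :: l) s)) *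
      (lift S.w p * S.pre s)⁻¹ := by
    rw [hp, _root_.map_mul, _root_.map_mul, _root_.map_inv, S.lift_mk_eq hs]
    group
  have h₂ : lift S.w f₂ = (lift S.w q * S.pre t) * mk (gapWord (S.code (t :: m) t)) *
      (lift S.w q * S.pre t)⁻¹ := by
    rw [hq, _root_.map_mul, _root_.map_mul, _root_.map_inv, S.lift_mk_eq ht]
    group
  have H₁ := hasProfile_code hr hs (lift S.w p * S.pre s)
  have H₂ := hasProfile_code hr ht (lift S.w q * S.pre t)
  rw [← hS, ← h₁] at H₁
  rw [← hS, ← h₂, ← h] at H₂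
  obtain ⟨k, σ, hσ, rfl⟩ := H₁.exists_eq_conj_mul δ H₂
  obtain ⟨π, e, rfl⟩ := eq_signedPerm_of_mem_isometries hσ
  set U := S.code (s :: l) s with hU
  set V := S.code (t :: m) t with hV
  have hUc : IsCyclicallyReduced (gapWord U) :=
    isCyclicallyReduced_gapWord (S.isChain_code_append hs)
  have hVc : IsCyclicallyReduced (gapWord V) :=
    isCyclicallyReduced_gapWord (S.isChain_code_append ht)
  obtain ⟨g, hg⟩ : ∃ g, mk ((gapWord U).map (signedLetter π e)) = g * mk (gapWord V) * g⁻¹ := by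
    refine ⟨(k * signedPerm π e (lift S.w p * S.pre s))⁻¹ * (lift S.w q * S.pre t), ?_⟩
    rw [h₁, h₂, MulAut.mul_apply, MulAut.conj_apply] at h
    rw [_root_.map_mul, _root_.map_mul (signedPerm π e) (lift S.w p * S.pre s),
      signedPerm_mk, _root_.map_inv] at h
    generalize lift S.w q * S.pre t = y at *
    generalize signedPerm π e (lift S.w p * S.pre s) = x at *
    have : mk (gapWord V) = y⁻¹ * (y * mk (gapWord V) * y⁻¹) * y := by group
    rw [this, ← h]
    group
  have hUl := length_code_lt hr (SyncCode.isReduced_append_head hs)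
  have hVl := length_code_lt hr (SyncCode.isReduced_append_head ht)
  have hcount := countP_eq_of_conj (hUc.map_signedLetter π e) hVc hg
  have hne : π 0 ≠ π 1 := fun h => by simpa using π.injective h
  -- An exchange would swap the letter counts, but both words have fewer `a`'s than `b`'s.
  have hπ : π 0 = 0 := by
    by_contra h0
    have hπ0 : π 0 = 1 := by omega
    have hπ1 : π 1 = 0 := by omega
    have c0 := hcount fun x => x.1 = 0
    have c1 := hcount fun x => x.1 = 1
    have hs : ∀ y : Fin 2 × Bool, ((signedLetter π e y).1 = 1 ↔ y.1 = 0) ∧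
        ((signedLetter π e y).1 = 0 ↔ y.1 = 1) := by
      rintro ⟨i, f⟩
      fin_cases i <;> simp [signedLetter, hπ0, hπ1]
    rw [List.countP_map, countP_zero_gapWord] at c0
    rw [List.countP_map, countP_one_gapWord] at c1
    simp only [Function.comp_def, hs] at c0 c1
    rw [countP_one_gapWord] at c0
    rw [countP_zero_gapWord] at c1
    rw [← hS, ← hU] at hUl
    rw [← hS, ← hV] at hVl
    omega
  have hπ1 : π 1 = 1 := by omega
  rw [map_signedLetter_gapWord hπ] at hg
  set μ : Bool × ℤ → Bool × ℤ := fun x => (x.1 == e 0, sgn (e 1) * x.2) with hμ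
  have hchain : ((U.map μ) ++ [μ (S.head s)]).IsChain GapFit := by
    have h1 : (U ++ [S.head s]).IsChain GapFit := S.isChain_code_append hs
    have h2 : (U.map μ) ++ [μ (S.head s)] = (U ++ [S.head s]).map μ := by simp
    rw [h2, List.isChain_map]
    refine h1.imp fun x y hxy => ?_
    unfold GapFit at *
    simp only [hμ]
    intro hne
    have := hxy fun h => hne (by rw [h])
    cases e 1 <;> simpa using this
  have htriv : e 0 = true ∧ e 1 = true := by
    obtain ⟨_, j, u, v, -, huv⟩ := exists_gapWord_infix (g := g) hchain
      (S.isChain_code_append ht) (by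
        have h1 : mk (gapWord (U.map μ)) * g = g * mk (gapWord V) := by rw [hg]; group
        exact h1)
    have h1 : (List.replicate j (U.map μ)).flatten = u ++ V.dropLast ++ v := huv
    have h2 : (List.replicate j (U.map μ)).flatten =
        (S.code (List.replicate j (s :: l)).flatten s).map μ := by
      rw [S.code_replicate, List.map_flatten, List.map_replicate]
    rw [h2] at h1
    refine eq_true_of_infix hr ?_ (e 0) (e 1) h1
    have := (hs.flatten_replicate (j + 1)).isReduced
    rw [List.replicate_succ', List.flatten_concat] at this
    exact this.infix ⟨[], l, by simp⟩
  have hσ1 : signedPerm π e = 1 := by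
    apply mulAut_ext
    · rw [of, signedPerm_mk]; simp [signedLetter, hπ, htriv]
    · rw [of, signedPerm_mk]; simp [signedLetter, hπ1, htriv]
  rw [hσ1, mul_one] at h ⊢
  refine ⟨k, ?_, rfl⟩
  have hk := S.malnormal hf (f₂ := f₂) (g := k⁻¹) (by
    rw [← h, MulAut.conj_apply]
    group)
  simpa using inv_mem hk

theorem isMalcharacteristic_range (r : ℕ) (hr : 2 ≤ r) :
    (lift (seedCode r hr).w).range.IsMalcharacteristic := by
  intro δ hδ
  obtain ⟨⟨x, ⟨y, ⟨f₁, rfl⟩, hy⟩, ⟨f₂, hf₂⟩⟩, hx1⟩ := Subgroup.ne_bot_iff_exists_ne_one.1 hδ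
  refine mem_range_of_apply_eq hr (f₁ := f₁) (f₂ := f₂) ?_ (hy.trans hf₂.symm)
  rintro rfl
  apply hx1
  apply Subtype.ext
  change x = 1
  rw [← hy]
  simp

theorem exists_le_L_isMalcharacteristic (r : ℕ) (hr : 2 ≤ r) (κ : Cardinal.{0})
    (hκ : κ ≤ Cardinal.aleph0) : ∃ M : Subgroup (FreeGroup (Fin 2)),
      M ≤ L (r + 3) ∧ M.IsMalcharacteristic ∧ IsFreeOfRank M κ := by
  have hc : Countable κ.out := by
    rw [← Cardinal.mk_le_aleph0_iff, Cardinal.mk_out]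
    exact hκ
  obtain ⟨f, hf⟩ := hc.exists_injective_nat
  set S := seedCode r hr
  set T := oddCode f hf
  refine ⟨((lift S.w).comp (lift T.w)).range, ?_, ?_, ?_⟩
  · rw [← range_lift_seedCode r hr]
    rintro _ ⟨x, rfl⟩
    exact ⟨lift T.w x, rfl⟩
  · exact isMalcharacteristic_range_comp S.lift_injective (isMalcharacteristic_range r hr)
      fun f₁ f₂ h₁ g hg => T.malnormal h₁ hg
  · have := isFreeOfRank_range (φ := (lift S.w).comp (lift T.w))
      (S.lift_injective.comp T.lift_injective)
    rwa [Cardinal.mk_out] at this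

end SeedSubgroup

theorem mainTheorem12 :
    -- `F(a, b)` contains malcharacteristic subgroups of every countable rank
    (∀ κ : Cardinal.{0}, κ ≤ Cardinal.aleph0 →
      ∃ M : Subgroup (FreeGroup (Fin 2)), M.IsMalcharacteristic ∧ IsFreeOfRank M κ) ∧
    -- and they can be found inside the explicit subgroup `L ρ`, for all large `ρ`
    (∃ ρ₀ : ℕ, ∀ ρ : ℕ, ρ₀ ≤ ρ →
      (SeedSubgroup.L ρ).IsMalcharacteristic ∧ IsFreeOfRank (SeedSubgroup.L ρ) 2 ∧
      ∀ κ : Cardinal.{0}, κ ≤ Cardinal.aleph0 →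
        ∃ M : Subgroup (FreeGroup (Fin 2)),
          M ≤ SeedSubgroup.L ρ ∧ M.IsMalcharacteristic ∧ IsFreeOfRank M κ) := by
  -- `ρ = r + 3`, with three syllable pairs reserved for the head and the junctions, and `2 ≤ r`.
  refine ⟨fun κ hκ => ?_, 5, fun ρ hρ => ?_⟩
  · obtain ⟨M, -, h⟩ := SeedSubgroup.exists_le_L_isMalcharacteristic 2 le_rfl κ hκ
    exact ⟨M, h⟩
  · obtain ⟨r, rfl⟩ : ∃ r, ρ = r + 3 := ⟨ρ - 3, by omega⟩
    have hr : 2 ≤ r := by omega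
    refine ⟨?_, ?_, SeedSubgroup.exists_le_L_isMalcharacteristic r hr⟩
    · rw [← SeedSubgroup.range_lift_seedCode r hr]
      exact SeedSubgroup.isMalcharacteristic_range r hr
    · rw [← SeedSubgroup.range_lift_seedCode r hr]
      simpa using FreeGroup.isFreeOfRank_range (SeedSubgroup.seedCode r hr).lift_injective
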